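/- **Lemma 2.8.** Let $n\ge 3$ and let $\Sigma\subset S^{n-1}\subset\mathbb R^n$ be an embedded $(n-2)$-dimensional $C^2$ submanifold with a continuous unit normal field $\nu:\Sigma\to S^{n-1}$, that is, $|\nu(x)|=1$, $\nu(x)\in T_xS^{n-1}$ and $\nu(x)\perp T_x\Sigma$ for all $x\in\Sigma$. Assume that - (i) if $n=3$, $\Sigma$ has nowhere vanishing geodesic curvature; - (ii) if $n\ge4$, $\Sigma$ has sectional curvature $>1$. (For a $C^2$ submanifold of $\mathbb R^n$ with vector-valued second fundamental form $\mathrm{II}$, the sectional curvature is $K(u,v)=\frac{\langle \mathrm{II}(u,u),\mathrm{II}(v,v)\rangle-|\mathrm{II}(u,v)|^2}{|u|^2|v|^2-\langle u,v\rangle^2}$. Principal curvatures with respect to $\nu$ are the eigenvalues, with multiplicity, of $\nabla\nu(x):T_x\Sigma\to T_x\Sigma$. The geodesic curvature with respect to $\nu$ is $-\langle\gamma'',\nu\rangle/|\gamma'|^2$ for a regular $C^2$ parametrization $\gamma$ of $\Sigma$.) Then the dual $\Sigma^*=\nu(\Sigma)$ is an immersed $C^2$ hypersurface of $S^{n-1}$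 satisfying (i), respectively (ii), with unit normal $x$ at $\nu(x)$. Precisely: every point of $\Sigma$ has a relatively open neighbourhood $V\subset\Sigma$ on which $\nu$ is a homeomorphism onto its image; and for every relatively open $V\subset \Sigma$ with this property (for instance $V=\Sigma$, if $\nu$ is an embedding), the set $V^*=\nu(V)\subset S^{n-1}$ is an embedded $(n-2)$-dimensional $C^2$ submanifold, $\nu^*:V^*\to S^{n-1}$, $\nu^*(\nu(x))=x$, is a continuous unit normal field of $V^*$, $V^*$ satisfies (i) if $n=3$ and (ii) if $n\ge 4$, and for every $x\in V$: - (a) if $n=3$, the geodesic curvature of $\Sigma$ at $x$ with respect to $\nu$ exists, and if it is $\kappa$, then the geodesic curvature of $V^*$ at $\nu(x)$ with respect to $\nu^*$ is $\kappa^{-1}$. If $n\ge4$, $\Sigma$ has $n-2$ real principal curvatures at $x$ with respect to $\nu$, attained on an orthonormal basis of principal directions of $T_x\Sigma$; if they are $\kappa_1,\dots,\kappa_{n-2}$, then all $\kappa_i\neq0$ and the principal curvatures of $V^*$ at $\nu(x)$ with respect to $\nu^*$ are $\kappa_1^{-1},\dots,\kappa_{n-2}^{-1}$; - (b) $T_{\nu(x)}V^*=T_x\Sigma$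 and $T_{\nu(x)}S^{n-1}=T_{\nu(x)}V^*\oplus\operatorname{span}\{x\}$. -/

import Mathlib

open Topology

namespace SphericalDual

noncomputable section

/-- Euclidean space of dimension `n`. -/
abbrev E (n : ℕ) : Type := EuclideanSpace ℝ (Fin n)

/-- The unit sphere of dimension `n - 1`, as a subset of Euclidean space of dimension `n`. -/
def unitSphere (n : ℕ) : Set (E n) := Metric.sphere (0 : E n) 1

/-! ### Embedded submanifolds -/

/-- `φ`, restricted to the open set `U` of `ℝᵐ`, is a local `C²` parametrization of `S`: a `C²`
immersion which is a homeomorphism onto a relatively open subset of `S`. -/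
structure IsLocalParam {m n : ℕ} (S : Set (E n)) (U : Set (E m)) (φ : E m → E n) : Prop where
  isOpen : IsOpen U
  contDiffOn : ContDiffOn ℝ 2 φ U
  immersion : ∀ u ∈ U, Function.Injective (fderiv ℝ φ u)
  isEmbedding : IsEmbedding (U.domRestrict φ)
  image_eq : ∃ W : Set (E n), IsOpen W ∧ φ '' U = S ∩ W

/-- `S` is an `m`-dimensional (embedded, boundaryless) `C²` submanifold of `ℝⁿ`. -/
def IsC2Submanifold {n : ℕ} (m : ℕ) (S : Set (E n)) : Prop :=
  ∀ p ∈ S, ∃ (U : Set (E m)) (φ : E m → E n), IsLocalParam S U φ ∧ p ∈ φ '' U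

/-- The tangent space of `S` at `p`: the span of the velocities at `p` of curves in `S` through
`p`. For a submanifold these velocities already form a linear subspace. -/
def tangentSpace {n : ℕ} (S : Set (E n)) (p : E n) : Submodule ℝ (E n) :=
  Submodule.span ℝ {v | ∃ γ : ℝ → E n,
    γ 0 = p ∧ (∀ᶠ t in 𝓝 (0 : ℝ), γ t ∈ S) ∧ HasDerivAt γ v 0}

/-- `ν` is a continuous unit normal field along `S`, as a hypersurface of the unit sphere: `ν x` is
a unit vector in the tangent space of the sphere at `x`, orthogonal to the tangent space of `S`. -/
structure IsUnitNormalField {n : ℕ} (S : Set (E n)) (ν : E n → E n) : Prop where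
  continuousOn : ContinuousOn ν S
  norm_eq_one : ∀ x ∈ S, ‖ν x‖ = 1
  mem_tangentSpace_sphere : ∀ x ∈ S, ν x ∈ tangentSpace (unitSphere n) x
  orthogonal : ∀ x ∈ S, ∀ v ∈ tangentSpace S x, inner ℝ (ν x) v = 0

/-! ### Curvatures -/

/-- `k` is the geodesic curvature at `x`, with respect to the unit normal field `ν`, of a curve `S`
lying in the unit sphere: `k = -⟪γ'', ν⟫ / |γ'|²` for a regular `C²` parametrization `γ` of `S`
near `x`. The sign is such that `k` is the factor in `(ν ∘ γ)' = k γ'`; reversing `ν` reverses it. -/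
def IsGeodesicCurvature {n : ℕ} (S : Set (E n)) (ν : E n → E n) (x : E n) (k : ℝ) : Prop :=
  ∃ γ : ℝ → E n, γ 0 = x ∧ (∀ᶠ t in 𝓝 (0 : ℝ), γ t ∈ S) ∧ ContDiffAt ℝ 2 γ 0 ∧
    deriv γ 0 ≠ 0 ∧ k = -inner ℝ (deriv (deriv γ) 0) (ν x) / ‖deriv γ 0‖ ^ 2

/-- The curve `S`, with unit normal field `ν`, has nowhere vanishing geodesic curvature (a condition
that does not change when `ν` is replaced by `-ν`). -/
def NonvanishingGeodesicCurvature {n : ℕ} (S : Set (E n)) (ν : E n → E n) : Prop :=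
  ∀ x ∈ S, ∀ k : ℝ, IsGeodesicCurvature S ν x k → k ≠ 0

/-- `κ 0, …, κ (m - 1)` are the principal curvatures, listed with multiplicity, of the
`m`-dimensional hypersurface `S` of the sphere at `x`, with respect to the unit normal field `ν`:
there is an orthonormal basis of the tangent space (the principal directions) consisting of
eigenvectors of the derivative of `ν` along `S`, with eigenvalues `κ i`. The derivative along `S`
is determined on the tangent space, so that the choice of `L` is immaterial. -/
def ArePrincipalCurvatures {n m : ℕ} (S : Set (E n)) (ν : E n → E n) (x : E n)
    (κ : Fin m → ℝ) : Prop :=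
  ∃ L : E n →L[ℝ] E n, HasFDerivWithinAt ν L S x ∧
    ∃ ξ : Fin m → E n, Orthonormal ℝ ξ ∧
      Submodule.span ℝ (Set.range ξ) = tangentSpace S x ∧ ∀ i, L (ξ i) = κ i • ξ i

/-- The (vector valued) second fundamental form of a `C²` immersion `φ` into Euclidean space: the
component of the second derivative that is normal to the image of the first derivative. -/
def secondFundamentalForm {m n : ℕ} (φ : E m → E n) (u a b : E m) : E n :=
  (LinearMap.range (fderiv ℝ φ u).toLinearMap)ᗮ.starProjection
    (fderiv ℝ (fun w => fderiv ℝ φ w) u a b)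

/-- The sectional curvature, at the point `φ u` and for the tangent plane spanned by the images of
`a` and `b`, of the metric induced by a `C²` immersion `φ` into Euclidean space. The induced metric
of a `C²` immersion is in general only `C¹`, and its curvature is the one given by the Gauss
equation in (flat) Euclidean space; for `C³` immersions this is the curvature of the Levi-Civita
connection. -/
def sectionalCurvature {m n : ℕ} (φ : E m → E n) (u a b : E m) : ℝ :=
  (inner ℝ (secondFundamentalForm φ u a a) (secondFundamentalForm φ u b b)
      - ‖secondFundamentalForm φ u a b‖ ^ 2) /
    (‖fderiv ℝ φ u a‖ ^ 2 * ‖fderiv ℝ φ u b‖ ^ 2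
      - (inner ℝ (fderiv ℝ φ u a) (fderiv ℝ φ u b)) ^ 2)

/-- All sectional curvatures of the `m`-dimensional submanifold `S` of `ℝⁿ` are larger than `c`. -/
def SectionalCurvatureGT {n : ℕ} (m : ℕ) (S : Set (E n)) (c : ℝ) : Prop :=
  ∀ (U : Set (E m)) (φ : E m → E n), IsLocalParam S U φ →
    ∀ u ∈ U, ∀ a b : E m, LinearIndependent ℝ ![a, b] → c < sectionalCurvature φ u a b

/-- The curvature condition on an `(n - 2)`-dimensional `C²` submanifold `S` of the sphere with unit
normal field `ν`: nonvanishing geodesic curvature if `n = 3`, sectional curvature larger than `1` if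
`n ≥ 4`. -/
def CurvatureCondition {n : ℕ} (S : Set (E n)) (ν : E n → E n) : Prop :=
  (n = 3 → NonvanishingGeodesicCurvature S ν) ∧ (4 ≤ n → SectionalCurvatureGT (n - 2) S 1)

/-- `V` is a relatively open subset of `S` on which `ν` is a topological embedding, so that
`ν '' V` is an embedded piece of the dual `ν '' S`. -/
structure IsEmbeddedPiece {n : ℕ} (S : Set (E n)) (ν : E n → E n) (V : Set (E n)) : Prop where
  relOpen : ∃ W : Set (E n), IsOpen W ∧ V = S ∩ W
  isEmbedding : IsEmbedding (V.domRestrict ν)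

end

end SphericalDual

open SphericalDual

namespace SphericalDual

open Set Filter

/-! ### Embeddings and immersions -/

/-! The tangent space at `x` is the orthogonal complement of the orthonormal pair `x`, `ν x`, a
description symmetric in the two vectors; duality exchanges their roles. A priori `ν` is only
continuous, but in a `C²` parametrization it solves linear equations with `C¹` coefficients, so it
is `C¹` (`contDiffAt_normal`). Its derivative `L` is a symmetric endomorphism of the tangent space.
Geodesic curvature is the quotient `⟪L v, v⟫ / ‖v‖²`. By the Gauss equation, sectional curvature
exceeds `1` exactly when all 2×2 minors of the form `⟪L ·, ·⟫` are positive. Either curvature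
condition makes `L` injective on tangent vectors, so `ν` is a `C¹` immersion and locally an
embedding. The image of `ν` has the same tangent space at `ν x` as `S` at `x`. Its tangent planes
are thus normal to two `C¹` fields, which upgrades the image from `C¹` to `C²` once it is written as
a graph (`contDiffAt_two_of_graph`, `isC2Submanifold_image`). The dual normal inverts `ν`, so its
derivative is `L⁻¹` on tangent vectors (`deriv_dual_normal`): eigenvalues are inverted and
eigenvectors kept. Substituting `L v` for `v` turns the form of `L⁻¹` into that of `L`, so the
curvature conditions persist. -/

theorem exists_isOpen_image_inter {X Y : Type*} [TopologicalSpace X] [TopologicalSpace Y]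
    {A : Set X} {f : X → Y} (hf : IsEmbedding (A.domRestrict f)) {W : Set X} (hW : IsOpen W) :
    ∃ W' : Set Y, IsOpen W' ∧ f '' (A ∩ W) = f '' A ∩ W' := by
  obtain ⟨W', hW', h⟩ := hf.isInducing.isOpen_iff.1 (hW.preimage (continuous_subtype_val (p := (· ∈ A))))
  refine ⟨W', hW', ?_⟩
  have key : ∀ a ∈ A, f a ∈ W' ↔ a ∈ W := fun a ha =>
    Set.ext_iff.1 h ⟨a, ha⟩
  ext y
  constructor
  · rintro ⟨a, ⟨ha, haW⟩, rfl⟩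
    exact ⟨⟨a, ha, rfl⟩, (key a ha).2 haW⟩
  · rintro ⟨⟨a, ha, rfl⟩, hy⟩
    exact ⟨a, ⟨ha, (key a ha).1 hy⟩, rfl⟩

theorem exists_clm_leftInverse {m n : ℕ} (A : E m →L[ℝ] E n) (hA : Function.Injective A) :
    ∃ P : E n →L[ℝ] E m, ∀ a, P (A a) = a := by
  obtain ⟨g, hg⟩ := LinearMap.exists_leftInverse_of_injective A.toLinearMap
    (LinearMap.ker_eq_bot.2 hA)
  exact ⟨g.toContinuousLinearMap, fun a => LinearMap.congr_fun hg a⟩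

/-- Following `f` with a linear left inverse `P` of its derivative gives a self-map of `E m` with
derivative the identity, to which the inverse function theorem applies. -/
theorem exists_contDiffAt_leftInverse {m n : ℕ} {f : E m → E n} {u : E m} {k : WithTop ℕ∞}
    (hk : k ≠ 0) (hf : ContDiffAt ℝ k f u) (hinj : Function.Injective (fderiv ℝ f u)) :
    ∃ g : E n → E m, ContDiffAt ℝ k g (f u) ∧ ∀ᶠ w in 𝓝 u, g (f w) = w := by
  obtain ⟨P, hP⟩ := exists_clm_leftInverse _ hinj
  have hPf : ContDiffAt ℝ k (fun w => P (f w)) u := P.contDiff.contDiffAt.comp u hf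
  have hd : HasFDerivAt (fun w => P (f w))
      ((ContinuousLinearEquiv.refl ℝ (E m) : E m ≃L[ℝ] E m) : E m →L[ℝ] E m) u := by
    have := P.hasFDerivAt.comp u (hf.differentiableAt hk).hasFDerivAt
    have e : P ∘L fderiv ℝ f u =
        ((ContinuousLinearEquiv.refl ℝ (E m) : E m ≃L[ℝ] E m) : E m →L[ℝ] E m) :=
      ContinuousLinearMap.ext hP
    rwa [e] at this
  refine ⟨fun y => hPf.localInverse hd hk (P y), ?_, ?_⟩
  · exact (hPf.to_localInverse hd hk).comp (f u) P.contDiff.contDiffAt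
  · exact (hPf.hasStrictFDerivAt' hd hk).eventually_left_inverse

/-! ### Local parametrizations and tangent spaces -/

section LocalParam

variable {m n : ℕ} {S : Set (E n)} {U : Set (E m)} {φ : E m → E n}

theorem IsLocalParam.mem (h : IsLocalParam S U φ) {u : E m} (hu : u ∈ U) : φ u ∈ S := by
  obtain ⟨W, -, hW⟩ := h.image_eq
  exact (hW.subset ⟨u, hu, rfl⟩).1

theorem IsLocalParam.contDiffAt (h : IsLocalParam S U φ) {u : E m} (hu : u ∈ U) :
    ContDiffAt ℝ 2 φ u :=
  h.contDiffOn.contDiffAt (h.isOpen.mem_nhds hu)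

theorem IsLocalParam.hasFDerivAt (h : IsLocalParam S U φ) {u : E m} (hu : u ∈ U) :
    HasFDerivAt φ (fderiv ℝ φ u) u :=
  ((h.contDiffAt hu).differentiableAt two_ne_zero).hasFDerivAt

theorem IsLocalParam.eventually_mem (h : IsLocalParam S U φ) {u : E m} (hu : u ∈ U) :
    ∀ᶠ w in 𝓝 u, w ∈ U :=
  h.isOpen.mem_nhds hu

theorem IsLocalParam.eventually_mem_image (h : IsLocalParam S U φ) {u : E m} (hu : u ∈ U)
    {O : Set (E m)} (hO : O ∈ 𝓝 u) : ∀ᶠ x in 𝓝[S] (φ u), x ∈ φ '' (U ∩ O) := by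
  obtain ⟨O', hO', hO'o, huO'⟩ := mem_nhds_iff.1 hO
  obtain ⟨W, hW, hWe⟩ := h.image_eq
  obtain ⟨W', hW', hWe'⟩ := exists_isOpen_image_inter h.isEmbedding hO'o
  have hmem : φ u ∈ W ∩ W' :=
    ⟨(hWe.subset ⟨u, hu, rfl⟩).2, (hWe'.subset ⟨u, ⟨hu, huO'⟩, rfl⟩).2⟩
  filter_upwards [inter_mem_nhdsWithin S ((hW.inter hW').mem_nhds hmem)] with x hx
  have : x ∈ φ '' (U ∩ O') := by
    rw [hWe', hWe]
    exact ⟨⟨hx.1, hx.2.1⟩, hx.2.2⟩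
  exact image_mono (inter_subset_inter_right U hO') this

/-- A local parametrization has a local inverse of class `C²`, defined in the ambient space. -/
theorem IsLocalParam.exists_inverse (h : IsLocalParam S U φ) {u : E m} (hu : u ∈ U) :
    ∃ ψ : E n → E m, ContDiffAt ℝ 2 ψ (φ u) ∧ ψ (φ u) = u ∧
      ∀ᶠ x in 𝓝[S] (φ u), ψ x ∈ U ∧ φ (ψ x) = x := by
  obtain ⟨ψ, hψ, hl⟩ := exists_contDiffAt_leftInverse two_ne_zero (h.contDiffAt hu)
    (h.immersion u hu)
  refine ⟨ψ, hψ, hl.self_of_nhds, ?_⟩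
  filter_upwards [h.eventually_mem_image hu hl] with x hx
  obtain ⟨w, ⟨hw, hw'⟩, rfl⟩ := hx
  have hw' : ψ (φ w) = w := hw'
  rw [hw']
  exact ⟨hw, rfl⟩

theorem IsLocalParam.exists_curve (h : IsLocalParam S U φ) {u : E m} (hu : u ∈ U) (a : E m) :
    ∃ γ : ℝ → E n, γ 0 = φ u ∧ (∀ᶠ t in 𝓝 (0 : ℝ), γ t ∈ S) ∧ ContDiffAt ℝ 2 γ 0 ∧
      HasDerivAt γ (fderiv ℝ φ u a) 0 := by
  have hl : ContDiff ℝ 2 (fun t : ℝ => u + t • a) := by fun_prop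
  have h0 : u + (0 : ℝ) • a = u := by simp
  have hd : HasDerivAt (fun t : ℝ => u + t • a) a 0 := by
    simpa using ((hasDerivAt_id (0 : ℝ)).smul_const a).const_add u
  refine ⟨fun t => φ (u + t • a), by simp, ?_, ?_, ?_⟩
  · have : ∀ᶠ t in 𝓝 (0 : ℝ), u + t • a ∈ U :=
      hl.continuous.continuousAt.eventually_mem (by rw [h0]; exact h.isOpen.mem_nhds hu)
    exact this.mono fun t ht => h.mem ht
  · exact ContDiffAt.comp (0 : ℝ) (by rw [h0]; exact h.contDiffAt hu) hl.contDiffAt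
  · exact HasFDerivAt.comp_hasDerivAt (0 : ℝ) (by rw [h0]; exact h.hasFDerivAt hu) hd

/-- A curve in `S` satisfies `γ = φ ∘ ψ ∘ γ` near `0` for a differentiable inverse `ψ`, so the chain
rule puts its velocity in the range. Conversely, images of straight lines realize every vector of
the range. -/
theorem IsLocalParam.tangentSpace_eq (h : IsLocalParam S U φ) {u : E m} (hu : u ∈ U) :
    tangentSpace S (φ u) = LinearMap.range (fderiv ℝ φ u).toLinearMap := by
  apply le_antisymm
  · refine Submodule.span_le.2 ?_
    rintro v ⟨γ, h0, hγ, hd⟩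
    obtain ⟨ψ, hψ, hψu, he⟩ := h.exists_inverse hu
    have hψd : HasFDerivAt ψ (fderiv ℝ ψ (φ u)) (γ 0) := by
      rw [h0]; exact (hψ.differentiableAt two_ne_zero).hasFDerivAt
    have hφd : HasFDerivAt φ (fderiv ℝ φ u) (ψ (γ 0)) := by
      rw [h0, hψu]; exact h.hasFDerivAt hu
    have hc := hφd.comp_hasDerivAt (0 : ℝ) (hψd.comp_hasDerivAt (0 : ℝ) hd)
    have ht : Tendsto γ (𝓝 0) (𝓝[S] (φ u)) :=
      tendsto_nhdsWithin_iff.2 ⟨h0 ▸ hd.continuousAt, hγ⟩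
    have hee : (φ ∘ ψ ∘ γ) =ᶠ[𝓝 0] γ := (ht.eventually he).mono fun t ht => ht.2
    exact ⟨_, (hc.congr_of_eventuallyEq hee.symm).unique hd⟩
  · rintro _ ⟨a, rfl⟩
    obtain ⟨γ, h0, hγ, -, hd⟩ := h.exists_curve hu a
    exact Submodule.subset_span ⟨γ, h0, hγ, hd⟩

end LocalParam

section Submanifold

variable {m n : ℕ} {S : Set (E n)} {p : E n}

theorem IsC2Submanifold.finrank_tangentSpace (hS : IsC2Submanifold m S) (hp : p ∈ S) :
    Module.finrank ℝ (tangentSpace S p) = m := by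
  obtain ⟨U, φ, h, u, hu, rfl⟩ := hS p hp
  rw [h.tangentSpace_eq hu, LinearMap.finrank_range_of_inj (h.immersion u hu)]
  simp

theorem IsC2Submanifold.exists_curve (hS : IsC2Submanifold m S) (hp : p ∈ S) {v : E n}
    (hv : v ∈ tangentSpace S p) :
    ∃ γ : ℝ → E n, γ 0 = p ∧ (∀ᶠ t in 𝓝 (0 : ℝ), γ t ∈ S) ∧ ContDiffAt ℝ 2 γ 0 ∧
      HasDerivAt γ v 0 := by
  obtain ⟨U, φ, h, u, hu, rfl⟩ := hS p hp
  rw [h.tangentSpace_eq hu] at hv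
  obtain ⟨a, rfl⟩ := hv
  exact h.exists_curve hu a

end Submanifold

theorem tangentSpace_unitSphere {n : ℕ} {x : E n} (hx : x ∈ unitSphere n) :
    tangentSpace (unitSphere n) x = (Submodule.span ℝ {x})ᗮ := by
  have hx1 : ‖x‖ = 1 := by simpa [unitSphere] using hx
  apply le_antisymm
  · refine Submodule.span_le.2 ?_
    rintro v ⟨γ, h0, hγ, hd⟩
    have h1 := hd.inner ℝ hd
    have h2 : (fun t => inner ℝ (γ t) (γ t)) =ᶠ[𝓝 0] fun _ => (1 : ℝ) := by
      filter_upwards [hγ] with t ht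
      have : ‖γ t‖ = 1 := by simpa [unitSphere] using ht
      rw [real_inner_self_eq_norm_sq, this]; norm_num
    have h3 := h1.unique ((hasDerivAt_const (0 : ℝ) (1 : ℝ)).congr_of_eventuallyEq h2)
    rw [h0, real_inner_comm x v] at h3
    rw [SetLike.mem_coe, Submodule.mem_orthogonal_singleton_iff_inner_right]
    linarith [real_inner_comm x v]
  · intro v hv
    rw [Submodule.mem_orthogonal_singleton_iff_inner_right] at hv
    rcases eq_or_ne v 0 with rfl | hv0
    · exact Submodule.zero_mem _
    have hvn : ‖v‖ ≠ 0 := norm_ne_zero_iff.2 hv0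
    -- The great circle through `x` with initial velocity `v`.
    refine Submodule.subset_span ⟨fun t => Real.cos (t * ‖v‖) • x +
      (Real.sin (t * ‖v‖) * ‖v‖⁻¹) • v, by simp, Eventually.of_forall fun t => ?_, ?_⟩
    · have : ‖Real.cos (t * ‖v‖) • x + (Real.sin (t * ‖v‖) * ‖v‖⁻¹) • v‖ ^ 2 = 1 := by
        rw [norm_add_sq_real, inner_smul_left, inner_smul_right, hv, norm_smul, norm_smul, hx1]
        simp only [norm_mul, norm_inv, norm_norm, Real.norm_eq_abs (Real.cos _),
          Real.norm_eq_abs (Real.sin _), mul_zero, add_zero, mul_one]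
        rw [mul_assoc, inv_mul_cancel₀ hvn, mul_one, sq_abs, sq_abs, Real.cos_sq_add_sin_sq]
      have h2 := (sq_eq_sq₀ (norm_nonneg _) zero_le_one).1 (this.trans (one_pow 2).symm)
      exact mem_sphere_zero_iff_norm.2 h2
    · have hm : HasDerivAt (fun t : ℝ => t * ‖v‖) ‖v‖ 0 := by
        simpa using (hasDerivAt_id (0 : ℝ)).mul_const ‖v‖
      have hc := (hm.cos.smul_const x).add ((hm.sin.mul_const ‖v‖⁻¹).smul_const v)
      have e : (-Real.sin (0 * ‖v‖) * ‖v‖) • x + (Real.cos (0 * ‖v‖) * ‖v‖ * ‖v‖⁻¹) • v = v := by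
        simp [hvn]
      rw [e] at hc
      exact hc

/-! ### Oriented hypersurfaces of the sphere -/

/-- `S` is an `m`-dimensional `C²` hypersurface of the unit sphere of `ℝⁿ`, where `n = m + 2`, with
continuous unit normal field `ν`. -/
structure IsOrientedHypersurface {n : ℕ} (m : ℕ) (S : Set (E n)) (ν : E n → E n) : Prop where
  dim : m + 2 = n
  subset : S ⊆ unitSphere n
  submanifold : IsC2Submanifold m S
  normal : IsUnitNormalField S ν

theorem tangentSpace_mono {n : ℕ} {S S' : Set (E n)} (h : S ⊆ S') (x : E n) :
    tangentSpace S x ≤ tangentSpace S' x :=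
  Submodule.span_mono fun _ ⟨γ, h0, hγ, hd⟩ => ⟨γ, h0, hγ.mono fun _ ht => h ht, hd⟩

theorem mem_orthogonal_pair {n : ℕ} {x y v : E n} :
    v ∈ (Submodule.span ℝ {x, y})ᗮ ↔ inner ℝ x v = 0 ∧ inner ℝ y v = 0 := by
  rw [Submodule.span_insert, ← Submodule.inf_orthogonal, Submodule.mem_inf,
    Submodule.mem_orthogonal_singleton_iff_inner_right,
    Submodule.mem_orthogonal_singleton_iff_inner_right]

theorem finrank_orthogonal_pair {n : ℕ} {x y : E n} (hx : ‖x‖ = 1) (hy : ‖y‖ = 1)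
    (hxy : inner ℝ x y = 0) : Module.finrank ℝ (Submodule.span ℝ {x, y})ᗮ + 2 = n := by
  have ho : Orthonormal ℝ ![x, y] := by
    rw [orthonormal_iff_ite]
    intro i j
    fin_cases i <;> fin_cases j <;> simp [hx, hy, hxy, real_inner_comm x y]
  have h2 : Module.finrank ℝ (Submodule.span ℝ {x, y}) = 2 := by
    have := finrank_span_eq_card ho.linearIndependent
    rwa [Matrix.range_cons, Matrix.range_cons, Matrix.range_empty, union_empty, singleton_union,
      Fintype.card_fin] at this
  have := (Submodule.span ℝ {x, y}).finrank_add_finrank_orthogonal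
  rw [h2, finrank_euclideanSpace_fin] at this
  omega

/-- Near a point where a family of linear maps between spaces of equal dimension is injective, the
family has left inverses which depend on the parameter as smoothly as the family does. -/
theorem exists_contDiffAt_clm_leftInverse {G F F' : Type*} [NormedAddCommGroup G] [NormedSpace ℝ G]
    [NormedAddCommGroup F] [NormedSpace ℝ F] [FiniteDimensional ℝ F]
    [NormedAddCommGroup F'] [NormedSpace ℝ F'] [FiniteDimensional ℝ F']
    {M : G → F →L[ℝ] F'} {u : G} {k : WithTop ℕ∞} (hM : ContDiffAt ℝ k M u)
    (hinj : Function.Injective (M u)) (hdim : Module.finrank ℝ F = Module.finrank ℝ F') :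
    ∃ R : G → F' →L[ℝ] F, ContDiffAt ℝ k R u ∧ ∀ᶠ w in 𝓝 u, ∀ v, R w (M w v) = v := by
  let e : F ≃L[ℝ] F' :=
    (LinearMap.linearEquivOfInjective (M u).toLinearMap hinj hdim).toContinuousLinearEquiv
  have he : (e : F →L[ℝ] F') = M u := by ext v; rfl
  have : CompleteSpace F := FiniteDimensional.complete ℝ F
  refine ⟨fun w => ContinuousLinearMap.inverse (M w), ?_, ?_⟩
  · exact ContDiffAt.comp u (he ▸ contDiffAt_map_inverse e) hM
  · have hn : ∀ᶠ D in 𝓝 (M u), D ∈ range ((↑) : (F ≃L[ℝ] F') → F →L[ℝ] F') :=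
      he ▸ ContinuousLinearEquiv.nhds e
    filter_upwards [hM.continuousAt.eventually hn] with w hw v
    obtain ⟨e', he'⟩ := hw
    rw [← he', ContinuousLinearMap.inverse_equiv]
    simp

theorem _root_.ContDiffAt.clm_prod {G F F₁ F₂ : Type*} [NormedAddCommGroup G] [NormedSpace ℝ G]
    [NormedAddCommGroup F] [NormedSpace ℝ F] [NormedAddCommGroup F₁] [NormedSpace ℝ F₁]
    [NormedAddCommGroup F₂] [NormedSpace ℝ F₂] {f : G → F →L[ℝ] F₁} {g : G → F →L[ℝ] F₂} {u : G}
    {k : WithTop ℕ∞} (hf : ContDiffAt ℝ k f u) (hg : ContDiffAt ℝ k g u) :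
    ContDiffAt ℝ k (fun w => (f w).prod (g w)) u :=
  (ContinuousLinearMap.prodₗᵢ ℝ :
    (F →L[ℝ] F₁) × (F →L[ℝ] F₂) ≃ₗᵢ[ℝ] F →L[ℝ] F₁ × F₂).toContinuousLinearEquiv.contDiff.contDiffAt.comp u (hf.prodMk hg)

/-- The linear map which sends `v` to the linear form `a ↦ ⟪v, D a⟫`. -/
noncomputable def innerSLComp {F₁ F₂ : Type*} [NormedAddCommGroup F₁] [NormedSpace ℝ F₁]
    [NormedAddCommGroup F₂] [InnerProductSpace ℝ F₂] (D : F₁ →L[ℝ] F₂) :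
    F₂ →L[ℝ] F₁ →L[ℝ] ℝ :=
  ((ContinuousLinearMap.compL ℝ F₁ F₂ ℝ).flip D).comp (innerSL ℝ)

theorem _root_.ContDiffAt.clm_innerSL_comp {G F₁ F₂ : Type*} [NormedAddCommGroup G]
    [NormedSpace ℝ G] [NormedAddCommGroup F₁] [NormedSpace ℝ F₁]
    [NormedAddCommGroup F₂] [InnerProductSpace ℝ F₂] {D : G → F₁ →L[ℝ] F₂} {u : G}
    {k : WithTop ℕ∞} (hD : ContDiffAt ℝ k D u) :
    ContDiffAt ℝ k (fun w => innerSLComp (D w)) u :=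
  have h : ContDiffAt ℝ k (fun w => (ContinuousLinearMap.compL ℝ F₁ F₂ ℝ).flip (D w)) u :=
    contDiffAt_const.clm_apply hD
  h.clm_comp contDiffAt_const

/-! ### Tangent spaces and regularity of the unit normal field -/

namespace IsOrientedHypersurface

variable {m n : ℕ} {S : Set (E n)} {ν : E n → E n} {U : Set (E m)} {φ : E m → E n} {x : E n}

theorem norm_eq_one (h : IsOrientedHypersurface m S ν) (hx : x ∈ S) : ‖x‖ = 1 :=
  mem_sphere_zero_iff_norm.1 (h.subset hx)

theorem inner_normal (h : IsOrientedHypersurface m S ν) (hx : x ∈ S) : inner ℝ x (ν x) = 0 := by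
  have := h.normal.mem_tangentSpace_sphere x hx
  rwa [tangentSpace_unitSphere (h.subset hx),
    Submodule.mem_orthogonal_singleton_iff_inner_right] at this

/-- Both `x` and `ν x` are normal to `S`, and the dimension count `m + 2 = n` leaves no room for
more. -/
theorem tangentSpace_eq (h : IsOrientedHypersurface m S ν) (hx : x ∈ S) :
    tangentSpace S x = (Submodule.span ℝ {x, ν x})ᗮ := by
  refine Submodule.eq_of_le_of_finrank_eq (fun v hv => mem_orthogonal_pair.2 ⟨?_, ?_⟩) ?_
  · have := tangentSpace_mono h.subset x hv
    rwa [tangentSpace_unitSphere (h.subset hx),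
      Submodule.mem_orthogonal_singleton_iff_inner_right] at this
  · exact h.normal.orthogonal x hx v hv
  · rw [h.submanifold.finrank_tangentSpace hx]
    have h1 := finrank_orthogonal_pair (h.norm_eq_one hx) (h.normal.norm_eq_one x hx)
      (h.inner_normal hx)
    have h2 := h.dim
    omega

theorem mem_tangentSpace (h : IsOrientedHypersurface m S ν) (hx : x ∈ S) {v : E n} :
    v ∈ tangentSpace S x ↔ inner ℝ x v = 0 ∧ inner ℝ (ν x) v = 0 := by
  rw [h.tangentSpace_eq hx, mem_orthogonal_pair]

theorem fderiv_mem (h : IsOrientedHypersurface m S ν) (hφ : IsLocalParam S U φ) {u : E m}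
    (hu : u ∈ U) (a : E m) :
    inner ℝ (φ u) (fderiv ℝ φ u a) = 0 ∧ inner ℝ (ν (φ u)) (fderiv ℝ φ u a) = 0 := by
  rw [← h.mem_tangentSpace (hφ.mem hu), hφ.tangentSpace_eq hu]
  exact ⟨a, rfl⟩

theorem tendsto_param (hφ : IsLocalParam S U φ) {u : E m} (hu : u ∈ U) :
    Tendsto φ (𝓝 u) (𝓝[S] (φ u)) :=
  tendsto_nhdsWithin_iff.2 ⟨(hφ.contDiffAt hu).continuousAt,
    (hφ.eventually_mem hu).mono fun _ hw => hφ.mem hw⟩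

/-- The unit normal field is of class `C¹` in a local parametrization. -/
theorem contDiffAt_normal (h : IsOrientedHypersurface m S ν) (hφ : IsLocalParam S U φ) {u : E m}
    (hu : u ∈ U) : ContDiffAt ℝ 1 (fun w => ν (φ w)) u := by
  have hS := hφ.mem hu
  set ν₀ := ν (φ u) with hν₀
  have hn0 : ‖ν₀‖ = 1 := h.normal.norm_eq_one _ hS
  -- `M w` pairs a vector with the tangent directions at `φ w`, with `φ w`, and with the fixed
  -- vector `ν₀`. These are `m + 2 = n` functionals, independent at `u` and `C¹` in `w`.
  let M : E m → E n →L[ℝ] (E m →L[ℝ] ℝ) × ℝ × ℝ := fun w =>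
    (innerSLComp (fderiv ℝ φ w)).prod
      ((innerSL ℝ (φ w)).prod (innerSL ℝ ν₀))
  have hMapp : ∀ w v, M w v = ((innerSL ℝ v).comp (fderiv ℝ φ w), inner ℝ (φ w) v, inner ℝ ν₀ v) :=
    fun w v => rfl
  have hM : ContDiffAt ℝ 1 M u := by
    have h1 : ContDiffAt ℝ 1 (fderiv ℝ φ) u := (hφ.contDiffAt hu).fderiv_right (by norm_num)
    have h2 : ContDiffAt ℝ 1 φ u := (hφ.contDiffAt hu).of_le (by norm_num)
    have h4 : ContDiffAt ℝ 1 (fun w => innerSL ℝ (φ w)) u :=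
      (innerSL ℝ : E n →L[ℝ] E n →L[ℝ] ℝ).contDiff.contDiffAt.comp u h2
    exact (h1.clm_innerSL_comp).clm_prod (h4.clm_prod contDiffAt_const)
  have hinj : Function.Injective (M u) := by
    refine (injective_iff_map_eq_zero _).2 fun v hv => ?_
    rw [hMapp, Prod.mk_eq_zero, Prod.mk_eq_zero] at hv
    obtain ⟨hv1, hv2, hv3⟩ := hv
    have hvT := (h.mem_tangentSpace hS).2 ⟨hv2, hv3⟩
    rw [hφ.tangentSpace_eq hu] at hvT
    obtain ⟨a, rfl⟩ := hvT
    exact inner_self_eq_zero.1 (DFunLike.congr_fun hv1 a)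
  have hdim : Module.finrank ℝ (E n) = Module.finrank ℝ ((E m →L[ℝ] ℝ) × ℝ × ℝ) := by
    rw [Module.finrank_prod, Module.finrank_prod, Module.finrank_self,
      ← LinearMap.toContinuousLinearMap.finrank_eq, Module.finrank_linearMap_self,
      finrank_euclideanSpace_fin, finrank_euclideanSpace_fin, ← h.dim]
  obtain ⟨R, hR, hRM⟩ := exists_contDiffAt_clm_leftInverse hM hinj hdim
  -- `W w` is normal to `S` and to `φ w`, with component `1` along `ν₀`; hence `ν (φ w)` is a
  -- multiple of it.
  let W : E m → E n := fun w => R w (0, 0, 1)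
  have hW : ContDiffAt ℝ 1 W u := hR.clm_apply contDiffAt_const
  have hν : ∀ᶠ w in 𝓝 u, ν (φ w) = (inner ℝ ν₀ (ν (φ w)) : ℝ) • W w := by
    filter_upwards [hRM, hφ.eventually_mem hu] with w hw hwU
    have e : M w (ν (φ w)) = (inner ℝ ν₀ (ν (φ w)) : ℝ) • (0, 0, 1) := by
      rw [hMapp, Prod.smul_mk, Prod.smul_mk, smul_zero, smul_zero, smul_eq_mul, mul_one,
        h.inner_normal (hφ.mem hwU)]
      refine Prod.ext (ContinuousLinearMap.ext fun a => ?_) rfl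
      exact (h.fderiv_mem hφ hwU a).2
    rw [← map_smul, ← e, hw]
  -- Continuity of `ν` fixes the sign, so `ν` is exactly the normalization of `W`.
  have hpos : ∀ᶠ w in 𝓝 u, 0 < inner ℝ ν₀ (ν (φ w)) := by
    have ht : Tendsto (fun w => (inner ℝ ν₀ (ν (φ w)) : ℝ)) (𝓝 u) (𝓝 (inner ℝ ν₀ ν₀)) :=
      tendsto_const_nhds.inner ((h.normal.continuousOn _ hS).tendsto.comp (tendsto_param hφ hu))
    refine ht.eventually_const_lt ?_
    rw [real_inner_self_eq_norm_sq, hn0]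
    norm_num
  have hWu : W u ≠ 0 := by
    intro h0
    have := hν.self_of_nhds
    rw [h0, smul_zero] at this
    rw [← hν₀] at this
    simp [this] at hn0
  refine ((hW.norm ℝ hWu).inv (norm_ne_zero_iff.2 hWu) |>.smul hW).congr_of_eventuallyEq ?_
  filter_upwards [hν, hpos, hφ.eventually_mem hu] with w h1 h2 h3
  have h4 := congrArg norm h1
  rw [h.normal.norm_eq_one _ (hφ.mem h3), norm_smul, Real.norm_of_nonneg h2.le] at h4
  rw [h1]
  congr 1
  exact eq_inv_of_mul_eq_one_left h4.symm

/-- The unit normal field is differentiable along the hypersurface. -/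
theorem exists_hasFDerivWithinAt (h : IsOrientedHypersurface m S ν) (hx : x ∈ S) :
    ∃ L : E n →L[ℝ] E n, HasFDerivWithinAt ν L S x := by
  obtain ⟨U, φ, hφ, u, hu, rfl⟩ := h.submanifold x hx
  obtain ⟨ψ, hψ, hψu, he⟩ := hφ.exists_inverse hu
  have hN : HasFDerivAt (fun w => ν (φ w)) (fderiv ℝ (fun w => ν (φ w)) u) (ψ (φ u)) := by
    rw [hψu]
    exact ((h.contDiffAt_normal hφ hu).differentiableAt one_ne_zero).hasFDerivAt
  -- Along `S`, `ν` agrees with `(ν ∘ φ) ∘ ψ`, which is differentiable in the ambient space.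
  refine ⟨_, (hN.comp _ (hψ.differentiableAt two_ne_zero).hasFDerivAt).hasFDerivWithinAt
    |>.congr_of_eventuallyEq (he.mono fun y hy => ?_) ?_⟩
  · exact congrArg ν hy.2.symm
  · exact congrArg ν (he.self_of_nhdsWithin hx).2.symm

theorem hasFDerivAt_normal (hφ : IsLocalParam S U φ) {u : E m} (hu : u ∈ U) {L : E n →L[ℝ] E n}
    (hL : HasFDerivWithinAt ν L S (φ u)) :
    HasFDerivAt (fun w => ν (φ w)) (L.comp (fderiv ℝ φ u)) u :=
  hL.comp_hasFDerivAt u (hφ.hasFDerivAt hu) ((hφ.eventually_mem hu).mono fun _ hw => hφ.mem hw)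

end IsOrientedHypersurface

theorem isEmbedding_domRestrict_of_leftInverse {X Y : Type*} [TopologicalSpace X]
    [TopologicalSpace Y] {V : Set X} {f : X → Y} {g : Y → X} (hf : ContinuousOn f V)
    (hg : ∀ x ∈ V, ContinuousAt g (f x)) (hl : ∀ x ∈ V, g (f x) = x) :
    IsEmbedding (V.domRestrict f) := by
  have hfc : Continuous (V.domRestrict f) := continuousOn_iff_continuous_domRestrict.1 hf
  refine ⟨isInducing_iff_nhds.2 fun x => le_antisymm (hfc.tendsto x).le_comap ?_, ?_⟩
  · rw [nhds_subtype_eq_comap, ← tendsto_iff_comap]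
    have ht : Tendsto g (𝓝 (f x)) (𝓝 x) := by
      have := (hg x x.2).tendsto
      rwa [hl x x.2] at this
    refine (ht.comp tendsto_comap).congr fun y => ?_
    exact hl y y.2
  · intro x y hxy
    apply Subtype.ext
    rw [← hl x x.2, ← hl y y.2]
    exact congrArg g hxy

theorem inner_sq_lt_of_linearIndependent {F : Type*} [NormedAddCommGroup F] [InnerProductSpace ℝ F]
    {v w : F} (h : LinearIndependent ℝ ![v, w]) :
    0 < ‖v‖ ^ 2 * ‖w‖ ^ 2 - (inner ℝ v w : ℝ) ^ 2 := by
  have hv : v ≠ 0 := h.ne_zero 0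
  have hv2 : 0 < ‖v‖ ^ 2 := by positivity
  -- The component of `w` orthogonal to `v`, scaled by `‖v‖ ^ 2`; its squared norm is `‖v‖ ^ 2`
  -- times the Gram determinant.
  have hz : ‖v‖ ^ 2 • w - (inner ℝ v w : ℝ) • v ≠ 0 := by
    intro h0
    have := (LinearIndependent.pair_iff.1 h (-(inner ℝ v w : ℝ)) (‖v‖ ^ 2) (by
      rw [neg_smul, add_comm, ← sub_eq_add_neg, h0])).2
    exact hv2.ne' this
  have hz2 : 0 < ‖‖v‖ ^ 2 • w - (inner ℝ v w : ℝ) • v‖ ^ 2 := by positivity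
  rw [norm_sub_sq_real, norm_smul, norm_smul, inner_smul_left, inner_smul_right,
    real_inner_comm v w, mul_pow, mul_pow, Real.norm_eq_abs, Real.norm_eq_abs, sq_abs, sq_abs] at hz2
  simp only [conj_trivial] at hz2
  refine pos_of_mul_pos_right (a := ‖v‖ ^ 2) ?_ hv2.le
  linarith

theorem mem_tangentSpace_of_hasDerivAt {n : ℕ} {S : Set (E n)} {γ : ℝ → E n} {t : ℝ} {v : E n}
    (hγ : ∀ᶠ s in 𝓝 t, γ s ∈ S) (hd : HasDerivAt γ v t) : v ∈ tangentSpace S (γ t) := by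
  have h1 : HasDerivAt (fun s : ℝ => t + s) 1 0 := (hasDerivAt_id 0).const_add t
  have h0 : t + 0 = t := add_zero t
  refine Submodule.subset_span ⟨fun s => γ (t + s), by simp, ?_, ?_⟩
  · have ht := h1.continuousAt.tendsto
    rw [h0] at ht
    exact ht.eventually hγ
  · have h2 : HasDerivAt γ v (t + 0) := by rwa [h0]
    have h3 := HasDerivAt.scomp (0 : ℝ) h2 h1
    rw [one_smul] at h3
    exact h3

/-! ### The derivative of the normal field and the curvature conditions -/

namespace IsOrientedHypersurface

variable {m n : ℕ} {S : Set (E n)} {ν : E n → E n} {U : Set (E m)} {φ : E m → E n} {x : E n}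
  {L : E n →L[ℝ] E n}

/-- The derivative of the normal field maps the tangent space to itself. -/
theorem deriv_normal_mem (h : IsOrientedHypersurface m S ν) (hx : x ∈ S)
    (hL : HasFDerivWithinAt ν L S x) {v : E n} (hv : v ∈ tangentSpace S x) :
    L v ∈ tangentSpace S x := by
  obtain ⟨γ, rfl, hγ, -, hd⟩ := h.submanifold.exists_curve hx hv
  have hνd := hL.comp_hasDerivAt (0 : ℝ) hd hγ
  refine (h.mem_tangentSpace hx).2 ⟨?_, ?_⟩
  · have h1 := hd.inner ℝ hνd
    have h2 : (fun t => inner ℝ (γ t) ((ν ∘ γ) t)) =ᶠ[𝓝 0] fun _ => (0 : ℝ) :=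
      hγ.mono fun t ht => h.inner_normal ht
    have h3 := h1.unique ((hasDerivAt_const (0 : ℝ) (0 : ℝ)).congr_of_eventuallyEq h2)
    have h4 := ((h.mem_tangentSpace hx).1 hv).2
    rw [real_inner_comm] at h4
    rw [Function.comp_apply, h4, add_zero] at h3
    exact h3
  · have h1 := hνd.inner ℝ hνd
    have h2 : (fun t => inner ℝ ((ν ∘ γ) t) ((ν ∘ γ) t)) =ᶠ[𝓝 0] fun _ => (1 : ℝ) := by
      filter_upwards [hγ] with t ht
      rw [real_inner_self_eq_norm_sq, Function.comp_apply, h.normal.norm_eq_one _ ht, one_pow]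
    have h3 := h1.unique ((hasDerivAt_const (0 : ℝ) (1 : ℝ)).congr_of_eventuallyEq h2)
    rw [Function.comp_apply, real_inner_comm (ν (γ 0)) (L v)] at h3
    linarith

/-- The product rule applied to `⟪g, dφ b⟫ = 0` in the direction `a`. With `g = φ` and `g = ν ∘ φ`
it gives the two normal components of the second derivative. -/
theorem inner_fderiv_fderiv (hφ : IsLocalParam S U φ) {u : E m} (hu : u ∈ U) {g : E m → E n}
    {g' : E m →L[ℝ] E n} (hg : HasFDerivAt g g' u) (b : E m)
    (h0 : ∀ w ∈ U, inner ℝ (g w) (fderiv ℝ φ w b) = 0) (a : E m) :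
    inner ℝ (g u) (fderiv ℝ (fun w => fderiv ℝ φ w) u a b) =
      -(inner ℝ (g' a) (fderiv ℝ φ u b) : ℝ) := by
  have hd : HasFDerivAt (fun w => fderiv ℝ φ w) (fderiv ℝ (fun w => fderiv ℝ φ w) u) u :=
    (((hφ.contDiffAt hu).fderiv_right (m := 1) (by norm_num)).differentiableAt
      one_ne_zero).hasFDerivAt
  have hdb := hd.clm_apply (hasFDerivAt_const b u)
  have h1 := hg.inner ℝ hdb
  have h2 : (fun w => inner ℝ (g w) (fderiv ℝ φ w b)) =ᶠ[𝓝 u] fun _ => (0 : ℝ) :=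
    (hφ.eventually_mem hu).mono h0
  have h3 := h1.unique ((hasFDerivAt_const (0 : ℝ) u).congr_of_eventuallyEq h2)
  have h4 := DFunLike.congr_fun h3 a
  simp at h4
  linarith

theorem inner_point_fderiv_fderiv (h : IsOrientedHypersurface m S ν) (hφ : IsLocalParam S U φ)
    {u : E m} (hu : u ∈ U) (a b : E m) :
    inner ℝ (φ u) (fderiv ℝ (fun w => fderiv ℝ φ w) u a b) =
      -(inner ℝ (fderiv ℝ φ u a) (fderiv ℝ φ u b) : ℝ) :=
  inner_fderiv_fderiv hφ hu (hφ.hasFDerivAt hu) b (fun _ hw => (h.fderiv_mem hφ hw b).1) a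

theorem inner_normal_fderiv_fderiv (h : IsOrientedHypersurface m S ν) (hφ : IsLocalParam S U φ)
    {u : E m} (hu : u ∈ U) (hL : HasFDerivWithinAt ν L S (φ u)) (a b : E m) :
    inner ℝ (ν (φ u)) (fderiv ℝ (fun w => fderiv ℝ φ w) u a b) =
      -(inner ℝ (L (fderiv ℝ φ u a)) (fderiv ℝ φ u b) : ℝ) :=
  inner_fderiv_fderiv hφ hu (hasFDerivAt_normal hφ hu hL) b
    (fun _ hw => (h.fderiv_mem hφ hw b).2) a

/-- The derivative of the normal field is symmetric on the tangent space. -/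
theorem inner_deriv_normal_comm (h : IsOrientedHypersurface m S ν) (hx : x ∈ S)
    (hL : HasFDerivWithinAt ν L S x) {v w : E n} (hv : v ∈ tangentSpace S x)
    (hw : w ∈ tangentSpace S x) : (inner ℝ (L v) w : ℝ) = inner ℝ v (L w) := by
  obtain ⟨U, φ, hφ, u, hu, rfl⟩ := h.submanifold x hx
  rw [hφ.tangentSpace_eq hu] at hv hw
  obtain ⟨a, rfl⟩ := hv
  obtain ⟨b, rfl⟩ := hw
  have h1 := h.inner_normal_fderiv_fderiv hφ hu hL a b
  have h2 := h.inner_normal_fderiv_fderiv hφ hu hL b a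
  have hs : fderiv ℝ (fun w => fderiv ℝ φ w) u a b = fderiv ℝ (fun w => fderiv ℝ φ w) u b a :=
    ((hφ.contDiffAt hu).isSymmSndFDerivAt (by simp)) a b
  rw [hs, h2] at h1
  exact (neg_injective h1).symm.trans (real_inner_comm _ _)

/-- The normal space has the orthonormal basis `φ u`, `ν (φ u)`, so the projection is read off from
its two components. -/
theorem secondFundamentalForm_eq (h : IsOrientedHypersurface m S ν) (hφ : IsLocalParam S U φ)
    {u : E m} (hu : u ∈ U) (hL : HasFDerivWithinAt ν L S (φ u)) (a b : E m) :
    secondFundamentalForm φ u a b = (-(inner ℝ (fderiv ℝ φ u a) (fderiv ℝ φ u b) : ℝ)) • φ u +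
      (-(inner ℝ (L (fderiv ℝ φ u a)) (fderiv ℝ φ u b) : ℝ)) • ν (φ u) := by
  have hx := hφ.mem hu
  have hxn : inner ℝ (φ u) (ν (φ u)) = 0 := h.inner_normal hx
  have hnx : inner ℝ (ν (φ u)) (φ u) = 0 := by rw [real_inner_comm, hxn]
  have hT := h.tangentSpace_eq hx
  rw [hφ.tangentSpace_eq hu] at hT
  refine Submodule.eq_starProjection_of_mem_orthogonal' (z := _) ?_ ?_ (add_sub_cancel _ _).symm
  · rw [hT, Submodule.orthogonal_orthogonal]
    exact Submodule.add_mem _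
      (Submodule.smul_mem _ _ (Submodule.subset_span (mem_insert _ _)))
      (Submodule.smul_mem _ _ (Submodule.subset_span (mem_insert_of_mem _ rfl)))
  · rw [Submodule.orthogonal_orthogonal, hT, mem_orthogonal_pair]
    constructor
    · rw [inner_sub_right, inner_add_right, inner_smul_right, inner_smul_right, hxn,
        h.inner_point_fderiv_fderiv hφ hu, real_inner_self_eq_norm_sq, h.norm_eq_one hx]
      ring
    · rw [inner_sub_right, inner_add_right, inner_smul_right, inner_smul_right, hnx,
        h.inner_normal_fderiv_fderiv hφ hu hL, real_inner_self_eq_norm_sq,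
        h.normal.norm_eq_one _ hx]
      ring

/-- The Gauss equation of a hypersurface of the sphere, for curvature larger than `1`. -/
theorem one_lt_sectionalCurvature_iff (h : IsOrientedHypersurface m S ν)
    (hφ : IsLocalParam S U φ) {u : E m} (hu : u ∈ U) (hL : HasFDerivWithinAt ν L S (φ u))
    {a b : E m} (hab : LinearIndependent ℝ ![fderiv ℝ φ u a, fderiv ℝ φ u b]) :
    1 < sectionalCurvature φ u a b ↔
      (inner ℝ (L (fderiv ℝ φ u a)) (fderiv ℝ φ u b) : ℝ) ^ 2 <
        inner ℝ (L (fderiv ℝ φ u a)) (fderiv ℝ φ u a) *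
          inner ℝ (L (fderiv ℝ φ u b)) (fderiv ℝ φ u b) := by
  have hx := hφ.mem hu
  have hxn : inner ℝ (φ u) (ν (φ u)) = 0 := h.inner_normal hx
  have hnx : inner ℝ (ν (φ u)) (φ u) = 0 := by rw [real_inner_comm, hxn]
  have hi : ∀ c d c' d' : ℝ,
      inner ℝ (c • φ u + d • ν (φ u)) (c' • φ u + d' • ν (φ u)) = c * c' + d * d' := by
    intro c d c' d'
    simp only [inner_add_left, inner_add_right, real_inner_smul_left, real_inner_smul_right, hxn,
      hnx, real_inner_self_eq_norm_sq, h.norm_eq_one hx, h.normal.norm_eq_one _ hx]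
    ring
  rw [sectionalCurvature, one_lt_div (inner_sq_lt_of_linearIndependent hab),
    ← real_inner_self_eq_norm_sq (secondFundamentalForm φ u a b),
    h.secondFundamentalForm_eq hφ hu hL, h.secondFundamentalForm_eq hφ hu hL,
    h.secondFundamentalForm_eq hφ hu hL, hi, hi, real_inner_self_eq_norm_sq,
    real_inner_self_eq_norm_sq]
  -- The components along `φ u` contribute exactly the Gram determinant, that is, curvature `1`; the
  -- comparison is left to the components along `ν`.
  constructor <;> intro hlt <;> nlinarith [hlt]

/-- Removes parametrizations from the curvature condition, so that it can be transported through
`L`. -/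
theorem sectionalCurvatureGT_iff (h : IsOrientedHypersurface m S ν) :
    SectionalCurvatureGT m S 1 ↔ ∀ x ∈ S, ∀ L : E n →L[ℝ] E n, HasFDerivWithinAt ν L S x →
      ∀ v ∈ tangentSpace S x, ∀ w ∈ tangentSpace S x, LinearIndependent ℝ ![v, w] →
        (inner ℝ (L v) w : ℝ) ^ 2 < inner ℝ (L v) v * inner ℝ (L w) w := by
  have hmap : ∀ (A : E m →L[ℝ] E n) (a b : E m), ![A a, A b] = A ∘ ![a, b] := by
    intro A a b
    ext i : 1
    fin_cases i <;> rfl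
  constructor
  · intro hK x hx L hL v hv w hw hvw
    obtain ⟨U, φ, hφ, u, hu, rfl⟩ := h.submanifold x hx
    rw [hφ.tangentSpace_eq hu] at hv hw
    obtain ⟨a, rfl⟩ := hv
    obtain ⟨b, rfl⟩ := hw
    refine (h.one_lt_sectionalCurvature_iff hφ hu hL hvw).1 (hK U φ hφ u hu a b ?_)
    refine LinearIndependent.of_comp (fderiv ℝ φ u).toLinearMap ?_
    have := hmap (fderiv ℝ φ u) a b
    exact this ▸ hvw
  · intro hK U φ hφ u hu a b hab
    have hx := hφ.mem hu
    obtain ⟨L, hL⟩ := h.exists_hasFDerivWithinAt hx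
    have hab' : LinearIndependent ℝ ![fderiv ℝ φ u a, fderiv ℝ φ u b] := by
      rw [hmap]
      exact hab.map' (fderiv ℝ φ u).toLinearMap (LinearMap.ker_eq_bot.2 (hφ.immersion u hu))
    have hT : ∀ a, fderiv ℝ φ u a ∈ tangentSpace S (φ u) := fun a => by
      rw [hφ.tangentSpace_eq hu]
      exact ⟨a, rfl⟩
    exact (h.one_lt_sectionalCurvature_iff hφ hu hL hab').2 (hK _ hx L hL _ (hT a) _ (hT b) hab')

theorem inner_deriv_deriv (h : IsOrientedHypersurface m S ν) {γ : ℝ → E n}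
    (hγ : ∀ᶠ t in 𝓝 (0 : ℝ), γ t ∈ S) (hγ2 : ContDiffAt ℝ 2 γ 0)
    (hL : HasFDerivWithinAt ν L S (γ 0)) :
    inner ℝ (deriv (deriv γ) 0) (ν (γ 0)) = -(inner ℝ (L (deriv γ 0)) (deriv γ 0) : ℝ) := by
  have hd1 : HasDerivAt γ (deriv γ 0) 0 := (hγ2.differentiableAt two_ne_zero).hasDerivAt
  have hd2 : HasDerivAt (deriv γ) (deriv (deriv γ) 0) 0 := by
    have h1 : ContDiffAt ℝ 1 (fderiv ℝ γ) 0 := hγ2.fderiv_right (by norm_num)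
    have h2 : ContDiffAt ℝ 1 (fun t => fderiv ℝ γ t 1) 0 := h1.clm_apply contDiffAt_const
    exact (h2.differentiableAt one_ne_zero).hasDerivAt
  have hν := hL.comp_hasDerivAt (0 : ℝ) hd1 hγ
  have h0 : (fun t => inner ℝ (deriv γ t) ((ν ∘ γ) t)) =ᶠ[𝓝 0] fun _ => (0 : ℝ) := by
    -- Differentiating `⟪γ', ν ∘ γ⟫ = 0` needs `γ'` tangent at all nearby times, not only at `0`.
    filter_upwards [hγ.eventually_nhds, hγ2.eventually (by simp)] with t ht ht2
    rw [real_inner_comm]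
    exact ((h.mem_tangentSpace ht.self_of_nhds).1 (mem_tangentSpace_of_hasDerivAt ht
      (ht2.differentiableAt two_ne_zero).hasDerivAt)).2
  have h1 := (hd2.inner ℝ hν).unique
    ((hasDerivAt_const (0 : ℝ) (0 : ℝ)).congr_of_eventuallyEq h0)
  rw [Function.comp_apply, real_inner_comm] at h1
  linarith

theorem isGeodesicCurvature_iff (h : IsOrientedHypersurface m S ν) (hx : x ∈ S)
    (hL : HasFDerivWithinAt ν L S x) {k : ℝ} :
    IsGeodesicCurvature S ν x k ↔
      ∃ v ∈ tangentSpace S x, v ≠ 0 ∧ k = inner ℝ (L v) v / ‖v‖ ^ 2 := by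
  constructor
  · rintro ⟨γ, rfl, hγ, hγ2, hne, rfl⟩
    refine ⟨deriv γ 0, mem_tangentSpace_of_hasDerivAt hγ
      (hγ2.differentiableAt two_ne_zero).hasDerivAt, hne, ?_⟩
    rw [h.inner_deriv_deriv hγ hγ2 hL, neg_neg]
  · rintro ⟨v, hv, hne, rfl⟩
    obtain ⟨γ, rfl, hγ, hγ2, hd⟩ := h.submanifold.exists_curve hx hv
    refine ⟨γ, rfl, hγ, hγ2, hd.deriv ▸ hne, ?_⟩
    rw [h.inner_deriv_deriv hγ hγ2 hL, neg_neg, hd.deriv]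

/-- The curvature condition makes the derivative of the normal field injective on the tangent
space. -/
theorem eq_zero_of_deriv_normal_eq_zero (h : IsOrientedHypersurface m S ν) (hn : 3 ≤ n)
    (hc : CurvatureCondition S ν) (hx : x ∈ S) (hL : HasFDerivWithinAt ν L S x) {v : E n}
    (hv : v ∈ tangentSpace S x) (h0 : L v = 0) : v = 0 := by
  by_contra hv0
  rcases hn.eq_or_lt with h3 | h4
  · exact hc.1 h3.symm x hx _ ((h.isGeodesicCurvature_iff hx hL).2 ⟨v, hv, hv0, rfl⟩)
      (by rw [h0, inner_zero_left, zero_div])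
  · obtain rfl : m = n - 2 := by have := h.dim; omega
    -- For `n ≥ 4` the tangent space has dimension at least two. A kernel vector `v` and an
    -- independent `w` would make the strict minor inequality read `0 < 0`.
    have hw : ∃ w ∈ tangentSpace S x, w ∉ Submodule.span ℝ {v} := by
      by_contra! hcon
      have h1 := Submodule.finrank_mono (show tangentSpace S x ≤ Submodule.span ℝ {v} from hcon)
      rw [h.submanifold.finrank_tangentSpace hx, finrank_span_singleton hv0] at h1
      omega
    obtain ⟨w, hw, hwv⟩ := hw
    have hli : LinearIndependent ℝ ![v, w] :=
      (LinearIndependent.pair_iff' hv0).2 fun a ha =>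
        hwv (Submodule.mem_span_singleton.2 ⟨a, ha⟩)
    have := h.sectionalCurvatureGT_iff.1 (hc.2 h4) x hx L hL v hv w hw hli
    simp [h0] at this

/-- If the derivative of the normal field is injective on tangent spaces, then the normal field is
a local embedding. -/
theorem exists_isEmbeddedPiece (h : IsOrientedHypersurface m S ν) (hx : x ∈ S)
    (hL : HasFDerivWithinAt ν L S x) (hinj : ∀ v ∈ tangentSpace S x, L v = 0 → v = 0) :
    ∃ V : Set (E n), x ∈ V ∧ IsEmbeddedPiece S ν V := by
  obtain ⟨U, φ, hφ, u, hu, rfl⟩ := h.submanifold x hx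
  obtain ⟨ψ, hψ, hψu, he⟩ := hφ.exists_inverse hu
  have hN := h.contDiffAt_normal hφ hu
  have hNinj : Function.Injective (fderiv ℝ (fun w => ν (φ w)) u) := by
    rw [(hasFDerivAt_normal hφ hu hL).fderiv]
    refine (injective_iff_map_eq_zero _).2 fun a ha => ?_
    have := hinj (fderiv ℝ φ u a) (by rw [hφ.tangentSpace_eq hu]; exact ⟨a, rfl⟩) ha
    exact (injective_iff_map_eq_zero _).1 (hφ.immersion u hu) a this
  obtain ⟨θ, hθ, hθN⟩ := exists_contDiffAt_leftInverse one_ne_zero hN hNinj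
  have hψt : Tendsto ψ (𝓝[S] (φ u)) (𝓝 u) := by
    have := hψ.continuousAt.tendsto
    rw [hψu] at this
    exact this.mono_left nhdsWithin_le_nhds
  have hev : ∀ᶠ y in 𝓝[S] (φ u), (ψ y ∈ U ∧ φ (ψ y) = y) ∧ θ (ν (φ (ψ y))) = ψ y ∧
      ContDiffAt ℝ 1 θ (ν y) :=
    he.and ((hψt.eventually hθN).and
      ((h.normal.continuousOn _ hx).tendsto.eventually (hθ.eventually (by simp))))
  obtain ⟨W, hW, hxW, hWS⟩ := mem_nhdsWithin.1 hev
  refine ⟨S ∩ W, ⟨hx, hxW⟩, ⟨W, hW, rfl⟩, ?_⟩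
  -- Since `θ` inverts `ν ∘ φ`, the composite `φ ∘ θ` inverts `ν` near the point.
  refine isEmbedding_domRestrict_of_leftInverse (g := φ ∘ θ)
    (h.normal.continuousOn.mono inter_subset_left) ?_ ?_
  · intro y hy
    obtain ⟨⟨h1, h2⟩, h3, h4⟩ := hWS hy.symm
    rw [h2] at h3
    exact ContinuousAt.comp (h3.symm ▸ (hφ.contDiffAt h1).continuousAt) h4.continuousAt
  · intro y hy
    obtain ⟨⟨h1, h2⟩, h3, h4⟩ := hWS hy.symm
    rw [h2] at h3
    rw [Function.comp_apply, h3, h2]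

end IsOrientedHypersurface

/-! ### Regularity of the dual -/

/-- A graph over `ℝᵐ` in `ℝᵐ⁺²` whose tangent spaces are normal to two vector fields of class `C¹`
is of class `C²`. -/
theorem contDiffAt_two_of_graph {m n : ℕ} (hdim : m + 2 = n) {F X Y : E m → E n}
    {P : E n →L[ℝ] E m} {v : E m} (hX : ContDiffAt ℝ 1 X v) (hY : ContDiffAt ℝ 1 Y v)
    (hF : ∀ᶠ w in 𝓝 v, DifferentiableAt ℝ F w ∧ ∀ a, P (fderiv ℝ F w a) = a ∧
      inner ℝ (X w) (fderiv ℝ F w a) = 0 ∧ inner ℝ (Y w) (fderiv ℝ F w a) = 0)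
    (hinj : ∀ z, P z = 0 → inner ℝ (X v) z = 0 → inner ℝ (Y v) z = 0 → z = 0) :
    ContDiffAt ℝ 2 F v := by
  let M : E m → E n →L[ℝ] E m × ℝ × ℝ := fun w =>
    P.prod ((innerSL ℝ (X w)).prod (innerSL ℝ (Y w)))
  have hMapp : ∀ w z, M w z = (P z, inner ℝ (X w) z, inner ℝ (Y w) z) := fun w z => rfl
  have hM : ContDiffAt ℝ 1 M v :=
    (contDiffAt_const (c := P)).clm_prod
      (((innerSL ℝ : E n →L[ℝ] E n →L[ℝ] ℝ).contDiff.contDiffAt.comp v hX).clm_prod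
        ((innerSL ℝ : E n →L[ℝ] E n →L[ℝ] ℝ).contDiff.contDiffAt.comp v hY))
  have hMinj : Function.Injective (M v) := by
    refine (injective_iff_map_eq_zero _).2 fun z hz => ?_
    rw [hMapp, Prod.mk_eq_zero, Prod.mk_eq_zero] at hz
    exact hinj z hz.1 hz.2.1 hz.2.2
  have hfr : Module.finrank ℝ (E n) = Module.finrank ℝ (E m × ℝ × ℝ) := by
    rw [Module.finrank_prod, Module.finrank_prod, Module.finrank_self,
      finrank_euclideanSpace_fin, finrank_euclideanSpace_fin, ← hdim]
  obtain ⟨R, hR, hRM⟩ := exists_contDiffAt_clm_leftInverse hM hMinj hfr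
  -- The vector `dF a` solves `M w z = (a, 0, 0)`, so `dF` is given by the `C¹` family `R`.
  have hd : ∀ᶠ w in 𝓝 v,
      HasFDerivAt F ((R w).comp (ContinuousLinearMap.inl ℝ (E m) (ℝ × ℝ))) w := by
    filter_upwards [hF, hRM] with w hw hRw
    have e : fderiv ℝ F w = (R w).comp (ContinuousLinearMap.inl ℝ (E m) (ℝ × ℝ)) := by
      refine ContinuousLinearMap.ext fun a => ?_
      obtain ⟨h1, h2, h3⟩ := hw.2 a
      have := hRw (fderiv ℝ F w a)
      rw [hMapp, h1, h2, h3] at this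
      exact this.symm
    exact e ▸ hw.1.hasFDerivAt
  have h2 : ContDiffAt ℝ ((1 : ℕ) + 1) F v :=
    contDiffAt_succ_iff_hasFDerivAt.2 ⟨_, ⟨_, hd, fun _ hw => hw⟩, hR.clm_comp contDiffAt_const⟩
  exact h2.of_le (by norm_num)

namespace IsOrientedHypersurface

variable {m n : ℕ} {S V : Set (E n)} {ν : E n → E n}

/-- The map `ν ∘ φ` is only `C¹`, so it cannot itself serve as a parametrization. Reparametrized by
its linear projection under `P`, the image becomes a graph, whose normals `x` and `ν x` are `C¹` in
the new parameter; this forces the graph to be `C²`. -/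
theorem isC2Submanifold_image (h : IsOrientedHypersurface m S ν)
    (hinj : ∀ x ∈ S, ∀ L : E n →L[ℝ] E n, HasFDerivWithinAt ν L S x →
      ∀ v ∈ tangentSpace S x, L v = 0 → v = 0)
    (hV : IsEmbeddedPiece S ν V) : IsC2Submanifold m (ν '' V) := by
  obtain ⟨⟨W₀, hW₀, rfl⟩, hemb⟩ := hV
  rintro _ ⟨x, ⟨hx, hxW⟩, rfl⟩
  obtain ⟨U, φ, hφ, u, hu, rfl⟩ := h.submanifold x hx
  obtain ⟨L, hL⟩ := h.exists_hasFDerivWithinAt hx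
  let N : E m → E n := fun w => ν (φ w)
  have hN : ∀ w ∈ U, ContDiffAt ℝ 1 N w := fun w hw => h.contDiffAt_normal hφ hw
  have hNd : fderiv ℝ N u = L.comp (fderiv ℝ φ u) := (hasFDerivAt_normal hφ hu hL).fderiv
  have hφT : ∀ w ∈ U, ∀ a, fderiv ℝ φ w a ∈ tangentSpace S (φ w) := fun w hw a => by
    rw [hφ.tangentSpace_eq hw]
    exact ⟨a, rfl⟩
  have hNT : ∀ w ∈ U, ∀ a, fderiv ℝ N w a ∈ tangentSpace S (φ w) := fun w hw a => by
    obtain ⟨L', hL'⟩ := h.exists_hasFDerivWithinAt (hφ.mem hw)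
    rw [(hasFDerivAt_normal hφ hw hL').fderiv]
    exact h.deriv_normal_mem (hφ.mem hw) hL' (hφT w hw a)
  have hNinj : Function.Injective (fderiv ℝ N u) := by
    rw [hNd]
    refine (injective_iff_map_eq_zero _).2 fun a ha => ?_
    exact (injective_iff_map_eq_zero _).1 (hφ.immersion u hu) a
      (hinj _ hx L hL _ (hφT u hu a) ha)
  have hNrange : LinearMap.range (fderiv ℝ N u).toLinearMap = tangentSpace S (φ u) := by
    refine Submodule.eq_of_le_of_finrank_eq ?_ ?_
    · rintro _ ⟨a, rfl⟩
      exact hNT u hu a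
    · rw [h.submanifold.finrank_tangentSpace hx, LinearMap.finrank_range_of_inj hNinj,
        finrank_euclideanSpace_fin]
  obtain ⟨P, hP⟩ := exists_clm_leftInverse _ hNinj
  have hPN : ContDiffAt ℝ 1 (fun w => P (N w)) u := P.contDiff.contDiffAt.comp u (hN u hu)
  have hPNd : HasFDerivAt (fun w => P (N w))
      ((ContinuousLinearEquiv.refl ℝ (E m) : E m ≃L[ℝ] E m) : E m →L[ℝ] E m) u := by
    have := P.hasFDerivAt.comp u ((hN u hu).differentiableAt one_ne_zero).hasFDerivAt
    have e : P ∘L fderiv ℝ N u =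
        ((ContinuousLinearEquiv.refl ℝ (E m) : E m ≃L[ℝ] E m) : E m →L[ℝ] E m) :=
      ContinuousLinearMap.ext hP
    rwa [e] at this
  let e := hPN.toOpenPartialHomeomorph _ hPNd one_ne_zero
  have he : ∀ w, e w = P (N w) := fun w => rfl
  have hue : u ∈ e.source := hPN.mem_toOpenPartialHomeomorph_source hPNd one_ne_zero
  have hut : e u ∈ e.target := e.map_source hue
  have heu : e.symm (e u) = u := e.left_inv hue
  have hg : ContDiffAt ℝ 1 e.symm (e u) := hPN.to_localInverse hPNd one_ne_zero
  let F : E m → E n := fun v => N (e.symm v)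
  have hPF : ∀ v ∈ e.target, P (F v) = v := fun v hv => e.right_inv hv
  have hgt : Tendsto e.symm (𝓝 (e u)) (𝓝 u) := by
    have := hg.continuousAt.tendsto
    rwa [heu] at this
  have hPd : ∀ v ∈ e.target, DifferentiableAt ℝ F v → ∀ a, P (fderiv ℝ F v a) = a := by
    intro v hv hd a
    have h1 := P.hasFDerivAt.comp v hd.hasFDerivAt
    have h2 : (P ∘ F) =ᶠ[𝓝 v] fun w => w := (e.open_target.eventually_mem hv).mono hPF
    exact DFunLike.congr_fun (h1.unique ((hasFDerivAt_id v).congr_of_eventuallyEq h2)) a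
  have hF2 : ContDiffAt ℝ 2 F (e u) := by
    -- The second normal field is `F` itself, the point on the dual; the first is the original
    -- point.
    refine contDiffAt_two_of_graph (P := P) (X := fun v => φ (e.symm v)) (Y := F) h.dim ?_ ?_ ?_ ?_
    · refine ContDiffAt.comp (g := φ) (e u) ?_ hg
      rw [heu]
      exact (hφ.contDiffAt hu).of_le (by norm_num)
    · refine ContDiffAt.comp (g := N) (e u) ?_ hg
      rw [heu]
      exact hN u hu
    · filter_upwards [hg.eventually (by simp), e.open_target.mem_nhds hut,
        hgt.eventually (hφ.eventually_mem hu)] with v h1 h2 h3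
      have hc := ((hN _ h3).differentiableAt one_ne_zero).hasFDerivAt.comp v
        (h1.differentiableAt one_ne_zero).hasFDerivAt
      have hFd : DifferentiableAt ℝ F v := hc.differentiableAt
      have hfd : fderiv ℝ F v = _ := hc.fderiv
      refine ⟨hFd, fun a => ⟨hPd v h2 hFd a, ?_⟩⟩
      rw [hfd]
      exact (h.mem_tangentSpace (hφ.mem h3)).1 (hNT _ h3 _)
    -- A vector normal to both fields is tangent, hence in the range of `dN`, where `P` is
    -- injective.
    · intro z h1 h2 h3
      change inner ℝ (ν (φ (e.symm (e u)))) z = 0 at h3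
      rw [heu] at h2 h3
      have hz := (h.mem_tangentSpace hx).2 ⟨h2, h3⟩
      rw [← hNrange] at hz
      obtain ⟨a, rfl⟩ := hz
      have ha : a = 0 := (hP a).symm.trans h1
      rw [ha, map_zero]
  have hW₀u : ∀ᶠ w in 𝓝 u, φ w ∈ W₀ :=
    (hφ.contDiffAt hu).continuousAt.eventually (hW₀.mem_nhds hxW)
  have hgood : ∀ᶠ v in 𝓝 (e u), v ∈ e.target ∧ (e.symm v ∈ U ∧ φ (e.symm v) ∈ W₀) ∧
      ContDiffAt ℝ 2 F v :=
    (e.open_target.eventually_mem hut).and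
      ((hgt.eventually ((hφ.eventually_mem hu).and hW₀u)).and (hF2.eventually (by simp)))
  obtain ⟨O, hO, hOo, huO⟩ := mem_nhds_iff.1 hgood
  refine ⟨O, F, ⟨hOo, fun v hv => (hO hv).2.2.contDiffWithinAt, fun v hv => ?_, ?_, ?_⟩,
    e u, huO, congrArg N heu⟩
  · have hd := hPd v (hO hv).1 ((hO hv).2.2.differentiableAt two_ne_zero)
    exact Function.LeftInverse.injective hd
  · exact isEmbedding_domRestrict_of_leftInverse
      (fun v hv => (hO hv).2.2.continuousAt.continuousWithinAt)
      (fun _ _ => P.continuous.continuousAt) fun v hv => hPF v (hO hv).1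
  -- Relative openness is carried from the parameter domain to `S` by `φ` and then to the dual by
  -- the embedding `ν`.
  · have hQ : IsOpen (e.symm '' O) :=
      e.symm.isOpen_image_of_subset_source hOo fun v hv => (hO hv).1
    have hQU : e.symm '' O ⊆ U := by
      rintro _ ⟨v, hv, rfl⟩
      exact (hO hv).2.1.1
    obtain ⟨W₁, hW₁, h1⟩ := exists_isOpen_image_inter hφ.isEmbedding hQ
    obtain ⟨W, hW, h2⟩ := hφ.image_eq
    rw [inter_eq_right.2 hQU, h2] at h1
    obtain ⟨W₂, hW₂, h3⟩ := exists_isOpen_image_inter hemb (hW.inter hW₁)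
    refine ⟨W₂, hW₂, ?_⟩
    have h4 : (S ∩ W₀) ∩ (W ∩ W₁) = φ '' (e.symm '' O) := by
      apply Subset.antisymm
      · rintro y ⟨⟨hy1, -⟩, hy2, hy3⟩
        rw [h1]
        exact ⟨⟨hy1, hy2⟩, hy3⟩
      · rintro y hy
        have hy0 : y ∈ W₀ := by
          obtain ⟨_, ⟨v, hv, rfl⟩, rfl⟩ := hy
          exact (hO hv).2.1.2
        rw [h1] at hy
        exact ⟨⟨hy.1.1, hy0⟩, hy.1.2, hy.2⟩
    rw [← h3, h4, image_image, image_image]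

end IsOrientedHypersurface

namespace IsOrientedHypersurface

variable {m n : ℕ} {S V : Set (E n)} {ν νs : E n → E n} {x : E n} {L Ls : E n →L[ℝ] E n}

/-! ### The dual hypersurface -/

theorem map_deriv_normal_eq (h : IsOrientedHypersurface m S ν) (hx : x ∈ S)
    (hL : HasFDerivWithinAt ν L S x) (hinj : ∀ v ∈ tangentSpace S x, L v = 0 → v = 0) :
    (tangentSpace S x).map L.toLinearMap = tangentSpace S x := by
  refine Submodule.eq_of_le_of_finrank_eq ?_ ?_
  · rintro _ ⟨v, hv, rfl⟩
    exact h.deriv_normal_mem hx hL hv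
  · have hi : Function.Injective (L.toLinearMap.domRestrict (tangentSpace S x)) :=
      (injective_iff_map_eq_zero _).2 fun v hv => Subtype.ext (hinj v v.2 hv)
    rw [← LinearMap.range_domRestrict, LinearMap.finrank_range_of_inj hi]

theorem exists_curve_piece (h : IsOrientedHypersurface m S ν) (hV : IsEmbeddedPiece S ν V)
    (hx : x ∈ V) {v : E n} (hv : v ∈ tangentSpace S x) :
    ∃ γ : ℝ → E n, γ 0 = x ∧ (∀ᶠ t in 𝓝 (0 : ℝ), γ t ∈ V) ∧ HasDerivAt γ v 0 := by
  obtain ⟨W, hW, rfl⟩ := hV.relOpen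
  obtain ⟨γ, rfl, hγ, -, hd⟩ := h.submanifold.exists_curve hx.1 hv
  exact ⟨γ, rfl, hγ.and (hd.continuousAt.eventually (hW.mem_nhds hx.2)), hd⟩

theorem _root_.SphericalDual.IsEmbeddedPiece.subset (hV : IsEmbeddedPiece S ν V) : V ⊆ S := by
  obtain ⟨W, -, rfl⟩ := hV.relOpen
  exact inter_subset_left

/-- Curves `ν ∘ γ` have velocities `L v`, which already fill the tangent space of `S`; equality
follows from equal dimensions. -/
theorem tangentSpace_image (h : IsOrientedHypersurface m S ν) (hV : IsEmbeddedPiece S ν V)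
    (hVs : IsC2Submanifold m (ν '' V)) (hx : x ∈ V) (hL : HasFDerivWithinAt ν L S x)
    (hinj : ∀ v ∈ tangentSpace S x, L v = 0 → v = 0) :
    tangentSpace (ν '' V) (ν x) = tangentSpace S x := by
  have hxS := hV.subset hx
  refine (Submodule.eq_of_le_of_finrank_eq ?_ ?_).symm
  · rw [← h.map_deriv_normal_eq hxS hL hinj]
    rintro _ ⟨v, hv, rfl⟩
    obtain ⟨γ, rfl, hγ, hd⟩ := h.exists_curve_piece hV hx hv
    have hνd := hL.comp_hasDerivAt (0 : ℝ) hd (hγ.mono fun t ht => hV.subset ht)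
    exact mem_tangentSpace_of_hasDerivAt (γ := ν ∘ γ) (hγ.mono fun t ht => mem_image_of_mem ν ht) hνd
  · rw [h.submanifold.finrank_tangentSpace hxS, hVs.finrank_tangentSpace (mem_image_of_mem ν hx)]

/-- Gives continuity of the dual normal; injectivity of `ν` on `V` alone would not suffice. -/
theorem continuousOn_leftInverse {X Y : Type*} [TopologicalSpace X] [TopologicalSpace Y]
    {V : Set X} {f : X → Y} {g : Y → X} (hf : IsEmbedding (V.domRestrict f))
    (hg : Set.LeftInvOn g f V) : ContinuousOn g (f '' V) := by
  refine continuousOn_iff'.2 fun W hW => ?_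
  obtain ⟨W', hW', he⟩ := exists_isOpen_image_inter hf hW
  refine ⟨W', hW', ?_⟩
  rw [inter_comm W', ← he]
  ext y
  constructor
  · rintro ⟨hy, z, hz, rfl⟩
    rw [mem_preimage, hg hz] at hy
    exact ⟨z, ⟨hz, hy⟩, rfl⟩
  · rintro ⟨z, ⟨hz, hzW⟩, rfl⟩
    exact ⟨by rwa [mem_preimage, hg hz], z, hz, rfl⟩

theorem dual (h : IsOrientedHypersurface m S ν)
    (hinj : ∀ x ∈ S, ∀ L : E n →L[ℝ] E n, HasFDerivWithinAt ν L S x →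
      ∀ v ∈ tangentSpace S x, L v = 0 → v = 0)
    (hV : IsEmbeddedPiece S ν V) (hνs : Set.LeftInvOn νs ν V) :
    IsOrientedHypersurface m (ν '' V) νs := by
  have hVS := hV.subset
  have hsph : ν '' V ⊆ unitSphere n := by
    rintro _ ⟨x, hx, rfl⟩
    exact mem_sphere_zero_iff_norm.2 (h.normal.norm_eq_one x (hVS hx))
  have hVs := h.isC2Submanifold_image hinj hV
  refine ⟨h.dim, hsph, hVs, continuousOn_leftInverse hV.isEmbedding hνs, ?_, ?_, ?_⟩
  · rintro _ ⟨x, hx, rfl⟩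
    rw [hνs hx, h.norm_eq_one (hVS hx)]
  · rintro _ ⟨x, hx, rfl⟩
    rw [tangentSpace_unitSphere (hsph (mem_image_of_mem ν hx)), hνs hx,
      Submodule.mem_orthogonal_singleton_iff_inner_right, real_inner_comm,
      h.inner_normal (hVS hx)]
  · rintro _ ⟨x, hx, rfl⟩ v hv
    obtain ⟨L, hL⟩ := h.exists_hasFDerivWithinAt (hVS hx)
    rw [h.tangentSpace_image hV hVs hx hL (hinj x (hVS hx) L hL)] at hv
    rw [hνs hx]
    exact ((h.mem_tangentSpace (hVS hx)).1 hv).1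

/-- The derivative of the dual normal field inverts the derivative of the normal field. -/
theorem deriv_dual_normal (h : IsOrientedHypersurface m S ν) (hV : IsEmbeddedPiece S ν V)
    (hνs : Set.LeftInvOn νs ν V) (hx : x ∈ V) (hL : HasFDerivWithinAt ν L S x)
    (hLs : HasFDerivWithinAt νs Ls (ν '' V) (ν x)) {v : E n} (hv : v ∈ tangentSpace S x) :
    Ls (L v) = v := by
  obtain ⟨γ, rfl, hγ, hd⟩ := h.exists_curve_piece hV hx hv
  have hνd := hL.comp_hasDerivAt (0 : ℝ) hd (hγ.mono fun t ht => hV.subset ht)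
  have hc := HasFDerivWithinAt.comp_hasDerivAt (f := ν ∘ γ) (0 : ℝ) hLs hνd
    (hγ.mono fun t ht => mem_image_of_mem ν ht)
  have he : νs ∘ ν ∘ γ =ᶠ[𝓝 0] γ := hγ.mono fun t ht => hνs ht
  exact (hc.congr_of_eventuallyEq he.symm).unique hd

/-! ### Curvatures of the dual -/

theorem sectionalCurvatureGT_dual (h : IsOrientedHypersurface m S ν)
    (hinj : ∀ x ∈ S, ∀ L : E n →L[ℝ] E n, HasFDerivWithinAt ν L S x →
      ∀ v ∈ tangentSpace S x, L v = 0 → v = 0)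
    (hV : IsEmbeddedPiece S ν V) (hνs : Set.LeftInvOn νs ν V)
    (hK : SectionalCurvatureGT m S 1) : SectionalCurvatureGT m (ν '' V) 1 := by
  have hd := h.dual hinj hV hνs
  refine hd.sectionalCurvatureGT_iff.2 ?_
  rintro _ ⟨x, hx, rfl⟩ Ls hLs v hv w hw hvw
  have hxS := hV.subset hx
  obtain ⟨L, hL⟩ := h.exists_hasFDerivWithinAt hxS
  have hLi := hinj x hxS L hL
  rw [h.tangentSpace_image hV hd.submanifold hx hL hLi,
    ← h.map_deriv_normal_eq hxS hL hLi] at hv hw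
  obtain ⟨v, hv, rfl⟩ := hv
  obtain ⟨w, hw, rfl⟩ := hw
  have hvw' : LinearIndependent ℝ ![v, w] := by
    refine LinearIndependent.of_comp L.toLinearMap ?_
    have e : ![L.toLinearMap v, L.toLinearMap w] = L.toLinearMap ∘ ![v, w] := by
      ext i : 1
      fin_cases i <;> rfl
    exact e ▸ hvw
  have := h.sectionalCurvatureGT_iff.1 hK x hxS L hL v hv w hw hvw'
  change (inner ℝ (Ls (L v)) (L w) : ℝ) ^ 2 < inner ℝ (Ls (L v)) (L v) * inner ℝ (Ls (L w)) (L w)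
  -- With `Ls (L v) = v` and the symmetry of `L`, the dual inequality at `L v`, `L w` is the
  -- original one at `v`, `w`.
  rw [h.deriv_dual_normal hV hνs hx hL hLs hv, h.deriv_dual_normal hV hνs hx hL hLs hw,
    ← h.inner_deriv_normal_comm hxS hL hv hw, ← h.inner_deriv_normal_comm hxS hL hv hv,
    ← h.inner_deriv_normal_comm hxS hL hw hw]
  exact this

/-- At `L v` the dual quotient has the same numerator `⟪L v, v⟫` as the original at `v`; only the
denominator changes. -/
theorem nonvanishingGeodesicCurvature_dual (h : IsOrientedHypersurface m S ν)
    (hinj : ∀ x ∈ S, ∀ L : E n →L[ℝ] E n, HasFDerivWithinAt ν L S x →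
      ∀ v ∈ tangentSpace S x, L v = 0 → v = 0)
    (hV : IsEmbeddedPiece S ν V) (hνs : Set.LeftInvOn νs ν V)
    (hK : NonvanishingGeodesicCurvature S ν) : NonvanishingGeodesicCurvature (ν '' V) νs := by
  have hd := h.dual hinj hV hνs
  rintro _ ⟨x, hx, rfl⟩ k hk
  have hxS := hV.subset hx
  obtain ⟨L, hL⟩ := h.exists_hasFDerivWithinAt hxS
  obtain ⟨Ls, hLs⟩ := hd.exists_hasFDerivWithinAt (mem_image_of_mem ν hx)
  have hLi := hinj x hxS L hL
  obtain ⟨w, hw, hw0, rfl⟩ := (hd.isGeodesicCurvature_iff (mem_image_of_mem ν hx) hLs).1 hk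
  rw [h.tangentSpace_image hV hd.submanifold hx hL hLi,
    ← h.map_deriv_normal_eq hxS hL hLi] at hw
  obtain ⟨v, hv, rfl⟩ := hw
  change L v ≠ 0 at hw0
  have hv0 : v ≠ 0 := fun h0 => hw0 (by rw [h0, map_zero])
  have hne := hK x hxS _ ((h.isGeodesicCurvature_iff hxS hL).2 ⟨v, hv, hv0, rfl⟩)
  change (inner ℝ (Ls (L v)) (L v) : ℝ) / ‖L v‖ ^ 2 ≠ 0
  rw [h.deriv_dual_normal hV hνs hx hL hLs hv, ← h.inner_deriv_normal_comm hxS hL hv hv]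
  exact div_ne_zero (div_ne_zero_iff.1 hne).1 (pow_ne_zero 2 (norm_ne_zero_iff.2 hw0))

theorem exists_isGeodesicCurvature (h : IsOrientedHypersurface m S ν) (hm : m ≠ 0) (hx : x ∈ S) :
    ∃ k, IsGeodesicCurvature S ν x k := by
  obtain ⟨L, hL⟩ := h.exists_hasFDerivWithinAt hx
  have hT : tangentSpace S x ≠ ⊥ := fun h0 => hm (by
    rw [← h.submanifold.finrank_tangentSpace hx, h0, finrank_bot])
  obtain ⟨v, hv, hv0⟩ := (Submodule.ne_bot_iff _).1 hT
  exact ⟨_, (h.isGeodesicCurvature_iff hx hL).2 ⟨v, hv, hv0, rfl⟩⟩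

/-- The tangent space is a line, so `L` acts on it as multiplication by `k` and its inverse as
multiplication by `k⁻¹`. -/
theorem isGeodesicCurvature_dual (h : IsOrientedHypersurface 1 S ν)
    (hinj : ∀ x ∈ S, ∀ L : E n →L[ℝ] E n, HasFDerivWithinAt ν L S x →
      ∀ v ∈ tangentSpace S x, L v = 0 → v = 0)
    (hV : IsEmbeddedPiece S ν V) (hνs : Set.LeftInvOn νs ν V) (hx : x ∈ V) {k : ℝ}
    (hk : IsGeodesicCurvature S ν x k) : IsGeodesicCurvature (ν '' V) νs (ν x) k⁻¹ := by
  have hd := h.dual hinj hV hνs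
  have hxS := hV.subset hx
  obtain ⟨L, hL⟩ := h.exists_hasFDerivWithinAt hxS
  obtain ⟨Ls, hLs⟩ := hd.exists_hasFDerivWithinAt (mem_image_of_mem ν hx)
  have hLi := hinj x hxS L hL
  obtain ⟨v, hv, hv0, hkv⟩ := (h.isGeodesicCurvature_iff hxS hL).1 hk
  have hvn : ‖v‖ ^ 2 ≠ 0 := pow_ne_zero 2 (norm_ne_zero_iff.2 hv0)
  obtain ⟨c, hc⟩ : ∃ c : ℝ, c • v = L v := by
    have hspan : Submodule.span ℝ {v} = tangentSpace S x := by
      refine Submodule.eq_of_le_of_finrank_eq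
        ((Submodule.span_singleton_le_iff_mem _ _).2 hv) ?_
      rw [finrank_span_singleton hv0, h.submanifold.finrank_tangentSpace hxS]
    have := h.deriv_normal_mem hxS hL hv
    rw [← hspan] at this
    exact Submodule.mem_span_singleton.1 this
  obtain rfl : k = c := by
    rw [hkv, ← hc, real_inner_smul_left, real_inner_self_eq_norm_sq, mul_div_cancel_right₀ _ hvn]
  have hk0 : k ≠ 0 := fun h0 => hv0 (hLi v hv (by rw [← hc, h0, zero_smul]))
  have hLsv : Ls v = k⁻¹ • v := by
    have := h.deriv_dual_normal hV hνs hx hL hLs hv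
    rw [← hc, map_smul] at this
    rw [eq_inv_smul_iff₀ hk0, this]
  refine (hd.isGeodesicCurvature_iff (mem_image_of_mem ν hx) hLs).2 ⟨v, ?_, hv0, ?_⟩
  · rwa [h.tangentSpace_image hV hd.submanifold hx hL hLi]
  · rw [hLsv, real_inner_smul_left, real_inner_self_eq_norm_sq, mul_div_cancel_right₀ _ hvn]

/-- The spectral theorem for the symmetric restriction of `L` to the tangent space. -/
theorem exists_arePrincipalCurvatures (h : IsOrientedHypersurface m S ν) (hx : x ∈ S) :
    ∃ κ : Fin m → ℝ, ArePrincipalCurvatures S ν x κ := by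
  obtain ⟨L, hL⟩ := h.exists_hasFDerivWithinAt hx
  let A : tangentSpace S x →ₗ[ℝ] tangentSpace S x :=
    L.toLinearMap.restrict fun v hv => h.deriv_normal_mem hx hL hv
  have hA : A.IsSymmetric := fun v w => h.inner_deriv_normal_comm hx hL v.2 w.2
  let b := hA.eigenvectorBasis (h.submanifold.finrank_tangentSpace hx)
  refine ⟨hA.eigenvalues (h.submanifold.finrank_tangentSpace hx), L, hL, fun i => b i, ?_, ?_, ?_⟩
  · exact b.orthonormal.comp_linearIsometry (tangentSpace S x).subtypeₗᵢ
  · have h1 : range (fun i => (b i : E n)) = (tangentSpace S x).subtype '' range b :=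
      (range_comp _ _)
    have h2 : Submodule.span ℝ (range b) = ⊤ := by
      rw [← b.coe_toBasis, b.toBasis.span_eq]
    rw [h1, Submodule.span_image, h2, Submodule.map_top, Submodule.range_subtype]
  · intro i
    exact congrArg Subtype.val
      (hA.apply_eigenvectorBasis (h.submanifold.finrank_tangentSpace hx) i)

/-- The same principal directions `ξ` serve for the dual, since inverse maps share eigenvectors. -/
theorem arePrincipalCurvatures_dual (h : IsOrientedHypersurface m S ν)
    (hinj : ∀ x ∈ S, ∀ L : E n →L[ℝ] E n, HasFDerivWithinAt ν L S x →
      ∀ v ∈ tangentSpace S x, L v = 0 → v = 0)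
    (hV : IsEmbeddedPiece S ν V) (hνs : Set.LeftInvOn νs ν V) (hx : x ∈ V) {κ : Fin m → ℝ}
    (hκ : ArePrincipalCurvatures S ν x κ) :
    (∀ i, κ i ≠ 0) ∧ ArePrincipalCurvatures (ν '' V) νs (ν x) (fun i => (κ i)⁻¹) := by
  have hd := h.dual hinj hV hνs
  have hxS := hV.subset hx
  obtain ⟨L, hL, ξ, hξ, hspan, hLξ⟩ := hκ
  obtain ⟨Ls, hLs⟩ := hd.exists_hasFDerivWithinAt (mem_image_of_mem ν hx)
  have hLi := hinj x hxS L hL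
  have hξT : ∀ i, ξ i ∈ tangentSpace S x := fun i =>
    hspan ▸ Submodule.subset_span (mem_range_self i)
  have hκ0 : ∀ i, κ i ≠ 0 := fun i h0 =>
    hξ.ne_zero i (hLi _ (hξT i) (by rw [hLξ, h0, zero_smul]))
  refine ⟨hκ0, Ls, hLs, ξ, hξ, ?_, fun i => ?_⟩
  · rw [hspan, h.tangentSpace_image hV hd.submanifold hx hL hLi]
  · have := h.deriv_dual_normal hV hνs hx hL hLs (hξT i)
    rw [hLξ, map_smul] at this
    rw [eq_inv_smul_iff₀ (hκ0 i), this]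

theorem tangentSpace_unitSphere_normal (h : IsOrientedHypersurface m S ν) (hx : x ∈ S) :
    tangentSpace (unitSphere n) (ν x) = tangentSpace S x ⊔ Submodule.span ℝ {x} := by
  rw [tangentSpace_unitSphere (mem_sphere_zero_iff_norm.2 (h.normal.norm_eq_one x hx))]
  have hnx : inner ℝ (ν x) x = 0 := by rw [real_inner_comm, h.inner_normal hx]
  apply le_antisymm
  · intro v hv
    rw [Submodule.mem_orthogonal_singleton_iff_inner_right] at hv
    -- Splits off the component of `v` along `x`; the remainder is orthogonal to `x` and, because
    -- `x` is orthogonal to `ν x`, still to `ν x`.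
    rw [← sub_add_cancel v ((inner ℝ x v : ℝ) • x)]
    refine Submodule.add_mem_sup ((h.mem_tangentSpace hx).2 ⟨?_, ?_⟩)
      (Submodule.smul_mem _ _ (Submodule.mem_span_singleton_self x))
    · rw [inner_sub_right, real_inner_smul_right, real_inner_self_eq_norm_sq, h.norm_eq_one hx]
      ring
    · rw [inner_sub_right, real_inner_smul_right, hnx, hv]
      ring
  · refine sup_le (fun v hv => ?_) ((Submodule.span_singleton_le_iff_mem _ _).2 ?_)
    · rw [Submodule.mem_orthogonal_singleton_iff_inner_right]
      exact ((h.mem_tangentSpace hx).1 hv).2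
    · rwa [Submodule.mem_orthogonal_singleton_iff_inner_right]

theorem disjoint_tangentSpace_span (h : IsOrientedHypersurface m S ν) (hx : x ∈ S) :
    Disjoint (tangentSpace S x) (Submodule.span ℝ {x}) := by
  refine Submodule.disjoint_def.2 fun v hv hvx => ?_
  obtain ⟨c, rfl⟩ := Submodule.mem_span_singleton.1 hvx
  have := ((h.mem_tangentSpace hx).1 hv).1
  rw [real_inner_smul_right, real_inner_self_eq_norm_sq, h.norm_eq_one hx, one_pow, mul_one] at this
  rw [this, zero_smul]

end IsOrientedHypersurface

end SphericalDual

theorem lemma2p8 (n : ℕ) (hn : 3 ≤ n) (S : Set (E n)) (hsph : S ⊆ unitSphere n)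
    (hS : IsC2Submanifold (n - 2) S) (ν : E n → E n) (hν : IsUnitNormalField S ν)
    (hcurv : CurvatureCondition S ν) :
    -- every point has a neighbourhood whose image is an embedded piece of the dual
    (∀ x ∈ S, ∃ V : Set (E n), x ∈ V ∧ IsEmbeddedPiece S ν V) ∧
    -- every embedded piece of the dual, with normal field `ν x ↦ x`, has the stated properties
    (∀ V : Set (E n), IsEmbeddedPiece S ν V →
      ∀ νs : E n → E n, Set.LeftInvOn νs ν V →
        ν '' V ⊆ unitSphere n ∧ IsC2Submanifold (n - 2) (ν '' V) ∧
        IsUnitNormalField (ν '' V) νs ∧ CurvatureCondition (ν '' V) νs ∧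
        ∀ x ∈ V,
          (n = 3 →
            (∃ k : ℝ, IsGeodesicCurvature S ν x k) ∧
            ∀ k : ℝ, IsGeodesicCurvature S ν x k →
              IsGeodesicCurvature (ν '' V) νs (ν x) k⁻¹) ∧
          (4 ≤ n →
            (∃ κ : Fin (n - 2) → ℝ, ArePrincipalCurvatures S ν x κ) ∧
            ∀ κ : Fin (n - 2) → ℝ, ArePrincipalCurvatures S ν x κ →
              (∀ i, κ i ≠ 0) ∧
              ArePrincipalCurvatures (ν '' V) νs (ν x) (fun i => (κ i)⁻¹)) ∧
          tangentSpace (ν '' V) (ν x) = tangentSpace S x ∧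
          tangentSpace (unitSphere n) (ν x)
            = tangentSpace (ν '' V) (ν x) ⊔ Submodule.span ℝ {x} ∧
          Disjoint (tangentSpace (ν '' V) (ν x)) (Submodule.span ℝ {x})) := by
  have h : IsOrientedHypersurface (n - 2) S ν := ⟨by omega, hsph, hS, hν⟩
  have hinj : ∀ x ∈ S, ∀ L : E n →L[ℝ] E n, HasFDerivWithinAt ν L S x →
      ∀ v ∈ tangentSpace S x, L v = 0 → v = 0 :=
    fun x hx L hL v hv h0 => h.eq_zero_of_deriv_normal_eq_zero hn hcurv hx hL hv h0
  refine ⟨fun x hx => ?_, fun V hV νs hνs => ?_⟩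
  · obtain ⟨L, hL⟩ := h.exists_hasFDerivWithinAt hx
    exact h.exists_isEmbeddedPiece hx hL (hinj x hx L hL)
  have hd := h.dual hinj hV hνs
  refine ⟨hd.subset, hd.submanifold, hd.normal,
    ⟨fun h3 => h.nonvanishingGeodesicCurvature_dual hinj hV hνs (hcurv.1 h3),
      fun h4 => h.sectionalCurvatureGT_dual hinj hV hνs (hcurv.2 h4)⟩, fun x hx => ?_⟩
  have hxS := hV.subset hx
  obtain ⟨L, hL⟩ := h.exists_hasFDerivWithinAt hxS
  have hT := h.tangentSpace_image hV hd.submanifold hx hL (hinj x hxS L hL)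
  refine ⟨fun h3 => ?_, fun _ => ?_, hT, ?_, ?_⟩
  -- After substitution `n - 2` reduces to `1`, as the statement for curves requires.
  · subst h3
    exact ⟨h.exists_isGeodesicCurvature one_ne_zero hxS,
      fun k hk =>
        IsOrientedHypersurface.isGeodesicCurvature_dual (n := 3) h hinj hV hνs hx hk⟩
  · exact ⟨h.exists_arePrincipalCurvatures hxS,
      fun κ hκ => h.arePrincipalCurvatures_dual hinj hV hνs hx hκ⟩
  · rw [hT, h.tangentSpace_unitSphere_normal hxS]
  · rw [hT]
    exact h.disjoint_tangentSpace_span hxS
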